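/- Let $\Omega\subset\mathbb R^d$ be open and let $\mathcal A=\sum_{\alpha}a_\alpha(x)\,\partial^\alpha$ (a finite sum over multi-indices) be a linear partial differential operator of arbitrary order with coefficients $a_\alpha\in C^\infty(\Omega;\mathbb R^{n\times N})$. Regard $\mathcal A$, in the sense of distributions, as an unbounded linear operator $\mathcal A:\mathrm W^{\mathcal A,1}(\Omega)\subset \mathrm L^1(\Omega;\mathbb R^N)\to \mathrm L^1(\Omega;\mathbb R^n)$ with domain $\mathrm W^{\mathcal A,1}(\Omega)=\{u\in \mathrm L^1(\Omega;\mathbb R^N):\mathcal A u\in \mathrm L^1(\Omega;\mathbb R^n)\}$. Its dual $\mathcal A^*$ has domain $$D(\mathcal A^*)=\{w^*\in \mathrm L^\infty(\Omega;\mathbb R^n):\ \exists\, c>0\ \ |\langle w^*,\mathcal A u\rangle|\le c\|u\|_{\mathrm L^1}\ \ \forall u\in \mathrm W^{\mathcal A,1}(\Omega)\},$$ and for $w^*\in D(\mathcal A^*)$, $\mathcal A^*w^*$ is the unique element of $\mathrm L^\infty(\Omega;\mathbb R^N)$ with $\langle w^*,\mathcal A u\rangle=\langle \mathcal A^*w^*,u\rangle$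 for all $u\in \mathrm W^{\mathcal A,1}(\Omega)$. Assume (H1) the range $\operatorname{im}\mathcal A=\{\mathcal A u:u\in \mathrm W^{\mathcal A,1}(\Omega)\}$ is closed in $\mathrm L^1(\Omega;\mathbb R^n)$. Let $f:\Omega\times\mathbb R^N\to[0,\infty)$ be continuous, with $f(x,\cdot)$ convex for every $x\in\Omega$, and such that for some $M>0$ $$\tfrac1M(|z|-1)\le |f(x,z)|\le M(1+|z|)\qquad\text{for all }(x,z)\in\Omega\times\mathbb R^N .$$ Assume also that $f(\cdot,0)\in \mathrm L^1(\Omega)$ (this is automatic if $\Omega$ has finite measure). Let $f^*(x,z^*)=\sup_{z\in\mathbb R^N}\{z^*\cdot z-f(x,z)\}$ and let $\tau\in\operatorname{im}\mathcal A$. Consider $$(\mathcal P)\quad \inf_{\substack{u\in \mathrm L^1(\Omega;\mathbb R^N)\\ \mathcal A u=\tau}}\int_\Omega f(x,u(x))\,dx,\qquad (\mathcal P^*)\quad \sup_{w^*\in D(\mathcal A^*)}\mathcal R[w^*],\quad \mathcal R[w^*]=\langle w^*,\tau\rangle-\int_\Omega f^*(x,\mathcal A^*w^*(x))\,dx .$$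 Then: 1. $(\mathcal P)$ and $(\mathcal P^*)$ are dual to each other. That is, for the perturbation $\Phi(u,p)=\int_\Omega f(x,u(x))\,dx$ if $u\in \mathrm W^{\mathcal A,1}(\Omega)$ and $\mathcal A u-p=\tau$, and $\Phi(u,p)=\infty$ otherwise, $(u,p)\in \mathrm L^1(\Omega;\mathbb R^N)\times\mathrm L^1(\Omega;\mathbb R^n)$, problem $(\mathcal P)$ is the minimization of $\Phi(\cdot,0)$ and $(\mathcal P^*)$ is the maximization of $-\Phi^*(0,\cdot)$ over $\mathrm L^\infty(\Omega;\mathbb R^n)$: $-\Phi^*(0,w^*)=\mathcal R[w^*]$ if $w^*\in D(\mathcal A^*)$, and $-\Phi^*(0,w^*)=-\infty$ otherwise. Moreover, with the Lagrangian $L(u,w^*)=-\sup_{p}\{\langle w^*,p\rangle-\Phi(u,p)\}$, one has $\sup_{w^*\in \mathrm L^\infty}L(u,w^*)=\Phi(u,0)$ for all $u\in \mathrm L^1(\Omega;\mathbb R^N)$ and $\inf_{u\in \mathrm L^1}L(u,w^*)=-\Phi^*(0,w^*)$ for all $w^*\in \mathrm L^\infty(\Omega;\mathbb R^n)$. 2.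 There is no duality gap: $$\inf_{\mathcal A u=\tau}\int_\Omega f(x,u(x))\,dx=\sup_{w^*\in D(\mathcal A^*)}\mathcal R[w^*].$$ 3. The supremum in $(\mathcal P^*)$ is attained at some $w^*\in D(\mathcal A^*)$. -/

import Mathlib

open MeasureTheory
open scoped ContDiff

noncomputable section

/-- The Euclidean space `ℝᵐ`. -/
abbrev Euc (m : ℕ) : Type := EuclideanSpace ℝ (Fin m)

/-- `L¹(Ω; ℝᵐ)` with respect to Lebesgue measure. -/
abbrev L1 {d : ℕ} (Ω : TopologicalSpace.Opens (Euc d)) (m : ℕ) : Type :=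
  Lp (Euc m) 1 (volume.restrict (Ω : Set (Euc d)))

/-- `L^∞(Ω; ℝᵐ)` with respect to Lebesgue measure. -/
abbrev LInfty {d : ℕ} (Ω : TopologicalSpace.Opens (Euc d)) (m : ℕ) : Type :=
  Lp (Euc m) ⊤ (volume.restrict (Ω : Set (Euc d)))

/-- The duality pairing `⟨w, u⟩ = ∫_Ω w · u dx` of `L^∞` and `L¹`. -/
def dualPair {d m : ℕ} {Ω : TopologicalSpace.Opens (Euc d)} (w : LInfty Ω m) (u : L1 Ω m) : ℝ :=
  ∫ x in (Ω : Set (Euc d)), inner ℝ (w x) (u x)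

/-! ### Linear partial differential operators -/

/-- The partial derivative `∂ᵢ g`. -/
def pderiv {d m : ℕ} (i : Fin d) (g : Euc d → Euc m) : Euc d → Euc m :=
  fun x => fderiv ℝ g x (EuclideanSpace.single i 1)

/-- The iterated partial derivative `∂^α g = ∂₀^(α 0) ∂₁^(α 1) ⋯ g` for a multi-index `α`. -/
def multiDeriv {d m : ℕ} (α : Fin d → ℕ) (g : Euc d → Euc m) : Euc d → Euc m :=
  (List.finRange d).foldr (fun i h => (pderiv i)^[α i] h) g

/-- A linear partial differential operator `𝒜 = ∑_α a_α(x) ∂^α` on `Ω` of arbitrary (finite) order,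
from `ℝᴺ`-valued to `ℝⁿ`-valued functions, with matrix coefficients that are smooth in `Ω`. -/
structure PDO {d : ℕ} (Ω : TopologicalSpace.Opens (Euc d)) (N n : ℕ) where
  /-- the finite set of multi-indices that occur -/
  indices : Finset (Fin d → ℕ)
  /-- the coefficient matrices `a_α(x)` -/
  coeff : (Fin d → ℕ) → Euc d → Matrix (Fin n) (Fin N) ℝ
  smooth : ∀ α ∈ indices, ∀ i j, ContDiffOn ℝ ∞ (fun x => coeff α x i j) (Ω : Set (Euc d))

/-- Smooth test functions with compact support in `Ω`. -/
structure IsTestFunction {d m : ℕ} (Ω : TopologicalSpace.Opens (Euc d)) (φ : Euc d → Euc m) :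
    Prop where
  contDiff : ContDiff ℝ ∞ φ
  hasCompactSupport : HasCompactSupport φ
  tsupport_subset : tsupport φ ⊆ (Ω : Set (Euc d))

namespace IsTestFunction

variable {d m : ℕ} {Ω : TopologicalSpace.Opens (Euc d)}

lemma pderiv {φ : Euc d → Euc m} (hφ : IsTestFunction Ω φ) (i : Fin d) :
    IsTestFunction Ω (pderiv i φ) := by
  have hsub : tsupport (_root_.pderiv i φ) ⊆ tsupport φ := by
    refine (closure_minimal ?_ (isClosed_tsupport φ))
    intro x hx
    by_contra hxs
    apply hx
    have : x ∉ tsupport (fderiv ℝ φ) := fun h => hxs (tsupport_fderiv_subset ℝ h)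
    simp [_root_.pderiv, image_eq_zero_of_notMem_tsupport this]
  refine ⟨?_, ?_, hsub.trans hφ.tsupport_subset⟩
  · exact (hφ.contDiff.fderiv_right (m := ∞) (by simp)).clm_apply contDiff_const
  · exact hφ.hasCompactSupport.of_isClosed_subset (isClosed_tsupport _) hsub

lemma multiDeriv {φ : Euc d → Euc m} (hφ : IsTestFunction Ω φ) (α : Fin d → ℕ) :
    IsTestFunction Ω (multiDeriv α φ) := by
  have key : ∀ l : List (Fin d), IsTestFunction Ω
      (l.foldr (fun i h => (_root_.pderiv i)^[α i] h) φ) := by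
    intro l
    induction l with
    | nil => exact hφ
    | cons i l ih =>
      simp only [List.foldr_cons]
      generalize α i = k
      induction k with
      | zero => exact ih
      | succ k ihk =>
        rw [Function.iterate_succ_apply']
        exact ihk.pderiv i
  exact key _

lemma zero : IsTestFunction Ω (fun _ => (0 : Euc m)) :=
  ⟨contDiff_const, HasCompactSupport.zero, by simp [tsupport, Function.support]⟩

lemma add {φ ψ : Euc d → Euc m} (hφ : IsTestFunction Ω φ) (hψ : IsTestFunction Ω ψ) :
    IsTestFunction Ω (fun x => φ x + ψ x) :=
  ⟨hφ.contDiff.add hψ.contDiff, hφ.hasCompactSupport.add hψ.hasCompactSupport,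
    (tsupport_add φ ψ).trans (Set.union_subset hφ.tsupport_subset hψ.tsupport_subset)⟩

lemma const_smul {φ : Euc d → Euc m} (hφ : IsTestFunction Ω φ) (c : ℝ) :
    IsTestFunction Ω (fun x => c • φ x) :=
  ⟨hφ.contDiff.const_smul c,
    hφ.hasCompactSupport.smul_left (f := fun _ => c),
    (tsupport_smul_subset_right (fun _ => c) φ).trans hφ.tsupport_subset⟩

lemma sum {ι : Type*} (s : Finset ι) {φ : ι → Euc d → Euc m}
    (h : ∀ i ∈ s, IsTestFunction Ω (φ i)) : IsTestFunction Ω (fun x => ∑ i ∈ s, φ i x) := by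
  classical
  induction s using Finset.induction_on with
  | empty => simpa using zero
  | insert a s ha ih =>
    simp only [Finset.sum_insert ha]
    exact (h a (Finset.mem_insert_self a s)).add
      (ih fun i hi => h i (Finset.mem_insert_of_mem hi))

lemma integrable_inner {ψ : Euc d → Euc m} (hψ : IsTestFunction Ω ψ) (u : L1 Ω m) :
    Integrable (fun x => inner ℝ (u x) (ψ x)) (volume.restrict (Ω : Set (Euc d))) := by
  obtain ⟨C, hC⟩ := hψ.hasCompactSupport.exists_bound_of_continuous hψ.contDiff.continuous
  have hu : Integrable u (volume.restrict (Ω : Set (Euc d))) := L1.integrable_coeFn u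
  refine (hu.norm.mul_const C).mono'
    (hu.aestronglyMeasurable.inner hψ.contDiff.continuous.aestronglyMeasurable) ?_
  filter_upwards with x
  exact (norm_inner_le_norm _ _).trans (mul_le_mul_of_nonneg_left (hC x) (norm_nonneg _))

end IsTestFunction

namespace PDO

variable {d N n : ℕ} {Ω : TopologicalSpace.Opens (Euc d)}

/-- The formal transpose `φ ↦ ∑_α (-1)^|α| ∂^α (a_αᵀ φ)` of `𝒜`, acting on test functions. -/
def transpose (A : PDO Ω N n) (φ : Euc d → Euc n) : Euc d → Euc N :=
  fun x => ∑ α ∈ A.indices, (-1 : ℝ) ^ (∑ i, α i) •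
    multiDeriv α (fun y => WithLp.toLp 2 ((A.coeff α y).transpose.mulVec (φ y).ofLp)) x

lemma isTestFunction_transpose (A : PDO Ω N n) {φ : Euc d → Euc n} (hφ : IsTestFunction Ω φ) :
    IsTestFunction Ω (A.transpose φ) := by
  refine IsTestFunction.sum _ fun α hα => IsTestFunction.const_smul
    (IsTestFunction.multiDeriv ?_ α) _
  have hsub : tsupport (fun y => (WithLp.toLp 2
      ((A.coeff α y).transpose.mulVec (φ y).ofLp) : Euc N)) ⊆ tsupport φ := by
    refine closure_mono fun x hx => ?_
    contrapose! hx
    have hx0 : φ x = 0 := by simpa using hx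
    simp [hx0]
  refine ⟨?_, hφ.hasCompactSupport.of_isClosed_subset (isClosed_tsupport _) hsub,
    hsub.trans hφ.tsupport_subset⟩
  rw [contDiff_iff_contDiffAt]
  intro x
  by_cases hx : x ∈ (Ω : Set (Euc d))
  · rw [contDiffAt_euclidean]
    intro j
    have : (fun y => (WithLp.toLp 2 ((A.coeff α y).transpose.mulVec (φ y).ofLp) : Euc N) j)
        = fun y => ∑ i, A.coeff α y i j * φ y i := by
      funext y
      simp [Matrix.mulVec, dotProduct, Matrix.transpose_apply]
    rw [this]
    refine ContDiffAt.sum fun i _ => ContDiffAt.mul ?_ ?_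
    · exact (A.smooth α hα i j).contDiffAt (Ω.isOpen.mem_nhds hx)
    · exact (contDiffAt_euclidean.1 hφ.contDiff.contDiffAt) i
  · have hx' : x ∉ tsupport (fun y => (WithLp.toLp 2
      ((A.coeff α y).transpose.mulVec (φ y).ofLp) : Euc N)) :=
      fun h => hx (hφ.tsupport_subset (hsub h))
    exact (contDiffAt_const (c := (0 : Euc N))).congr_of_eventuallyEq
      (notMem_tsupport_iff_eventuallyEq.1 hx')

/-- `𝒜 u = g` in `Ω` in the sense of distributions. -/
def IsDistribImage (A : PDO Ω N n) (u : L1 Ω N) (g : L1 Ω n) : Prop :=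
  ∀ φ : Euc d → Euc n, IsTestFunction Ω φ →
    ∫ x in (Ω : Set (Euc d)), inner ℝ (u x) (A.transpose φ x) =
      ∫ x in (Ω : Set (Euc d)), inner ℝ (g x) (φ x)

lemma integral_inner_add {m : ℕ} {ψ : Euc d → Euc m} (hψ : IsTestFunction Ω ψ)
    (u v : L1 Ω m) :
    ∫ x in (Ω : Set (Euc d)), inner ℝ ((u + v : L1 Ω m) x) (ψ x) =
      (∫ x in (Ω : Set (Euc d)), inner ℝ (u x) (ψ x)) +
        ∫ x in (Ω : Set (Euc d)), inner ℝ (v x) (ψ x) := by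
  rw [← integral_add (hψ.integrable_inner u) (hψ.integrable_inner v)]
  refine integral_congr_ae ?_
  filter_upwards [Lp.coeFn_add u v] with x hx
  rw [hx, Pi.add_apply, inner_add_left]

lemma integral_inner_smul {m : ℕ} (ψ : Euc d → Euc m) (c : ℝ) (u : L1 Ω m) :
    ∫ x in (Ω : Set (Euc d)), inner ℝ ((c • u : L1 Ω m) x) (ψ x) =
      c * ∫ x in (Ω : Set (Euc d)), inner ℝ (u x) (ψ x) := by
  rw [← integral_const_mul]
  refine integral_congr_ae ?_
  filter_upwards [Lp.coeFn_smul c u] with x hx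
  rw [hx, Pi.smul_apply, inner_smul_left]
  simp

lemma integral_inner_zero {m : ℕ} (ψ : Euc d → Euc m) :
    ∫ x in (Ω : Set (Euc d)), inner ℝ ((0 : L1 Ω m) x) (ψ x) = 0 := by
  rw [← integral_zero (Euc d) ℝ (μ := volume.restrict (Ω : Set (Euc d)))]
  refine integral_congr_ae ?_
  filter_upwards [Lp.coeFn_zero (Euc m) 1 (volume.restrict (Ω : Set (Euc d)))] with x hx
  rw [hx, Pi.zero_apply, inner_zero_left]

/-- The set of pairs `(u, 𝒜 u)` with `u ∈ L¹(Ω; ℝᴺ)` and `𝒜 u ∈ L¹(Ω; ℝⁿ)`. -/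
def distribGraph (A : PDO Ω N n) : Submodule ℝ (L1 Ω N × L1 Ω n) where
  carrier := {p | A.IsDistribImage p.1 p.2}
  zero_mem' := fun φ _ => by
    rw [Prod.fst_zero, Prod.snd_zero, integral_inner_zero, integral_inner_zero]
  add_mem' := fun {p q} hp hq φ hφ => by
    rw [Prod.fst_add, Prod.snd_add, integral_inner_add (A.isTestFunction_transpose hφ),
      integral_inner_add hφ, hp φ hφ, hq φ hφ]
  smul_mem' := fun c p hp φ hφ => by
    rw [Prod.smul_fst, Prod.smul_snd, integral_inner_smul, integral_inner_smul, hp φ hφ]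

/-- The unbounded operator `𝒜 : W^{𝒜,1}(Ω) ⊂ L¹(Ω; ℝᴺ) → L¹(Ω; ℝⁿ)`; its domain `W^{𝒜,1}(Ω)`
consists of the `u ∈ L¹` whose distributional image `𝒜 u` is in `L¹`. -/
def op (A : PDO Ω N n) : L1 Ω N →ₗ.[ℝ] L1 Ω n := A.distribGraph.toLinearPMap

lemma distribGraph_single_valued (A : PDO Ω N n) (p : L1 Ω N × L1 Ω n)
    (hp : p ∈ A.distribGraph) (h0 : p.1 = 0) : p.2 = 0 := by
  obtain ⟨u, g⟩ := p
  obtain rfl : u = 0 := h0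
  have hg : Integrable g (volume.restrict (Ω : Set (Euc d))) := L1.integrable_coeFn g
  have hcomp : ∀ i : Fin n, ∀ᵐ x ∂volume, x ∈ (Ω : Set (Euc d)) → g x i = 0 := by
    intro i
    refine Ω.isOpen.ae_eq_zero_of_integral_contDiff_smul_eq_zero ?_ ?_
    · have : IntegrableOn (fun x => g x i) (Ω : Set (Euc d)) volume :=
        (EuclideanSpace.proj (𝕜 := ℝ) i).integrable_comp hg
      exact this.locallyIntegrableOn
    · intro η hη hηc hηs
      have hφ : IsTestFunction Ω (fun x => η x • (EuclideanSpace.single i (1 : ℝ) : Euc n)) := by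
        refine ⟨hη.smul contDiff_const, hηc.smul_right, ?_⟩
        exact (tsupport_smul_subset_left η _).trans hηs
      have h1 := hp _ hφ
      rw [integral_inner_zero] at h1
      have h2 : ∫ x in (Ω : Set (Euc d)), η x • g x i = 0 := by
        rw [h1]
        refine integral_congr_ae (Filter.Eventually.of_forall fun x => ?_)
        simp [inner_smul_right, EuclideanSpace.inner_single_right]
      rwa [setIntegral_eq_integral_of_forall_compl_eq_zero] at h2
      intro x hx
      have : η x = 0 := image_eq_zero_of_notMem_tsupport fun h => hx (hηs h)
      simp [this]
  refine (Lp.eq_zero_iff_ae_eq_zero).2 ?_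
  rw [Filter.EventuallyEq, ae_restrict_iff' Ω.isOpen.measurableSet]
  filter_upwards [ae_all_iff.2 hcomp] with x hx hxΩ
  ext i
  exact hx i hxΩ

/-- The operator `𝒜` is the distributional one. -/
lemma mem_graph_op (A : PDO Ω N n) (u : L1 Ω N) (g : L1 Ω n) :
    (u, g) ∈ A.op.graph ↔ A.IsDistribImage u g := by
  rw [op, Submodule.toLinearPMap_graph_eq _ A.distribGraph_single_valued]
  rfl

/-- The domain `D(𝒜*) ⊂ L^∞(Ω; ℝⁿ)` of the dual operator. -/
def adjointDomain (A : PDO Ω N n) : Set (LInfty Ω n) :=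
  {w | ∃ c : ℝ, 0 < c ∧ ∀ u : A.op.domain, |dualPair w (A.op u)| ≤ c * ‖(u : L1 Ω N)‖}

/-- `v ∈ L^∞(Ω; ℝᴺ)` is the value of the dual operator at `w`. -/
def IsAdjointValue (A : PDO Ω N n) (w : LInfty Ω n) (v : LInfty Ω N) : Prop :=
  ∀ u : A.op.domain, dualPair w (A.op u) = dualPair v (u : L1 Ω N)

open Classical in
/-- The dual operator `𝒜*` (with value `0` outside its domain). -/
def adjoint (A : PDO Ω N n) (w : LInfty Ω n) : LInfty Ω N :=
  if h : ∃ v, A.IsAdjointValue w v then h.choose else 0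

end PDO

/-! ### The integral functionals -/

/-- `I_f(u) = ∫_Ω f(x, u(x)) dx ∈ [0, ∞]` for a nonnegative integrand `f`. -/
def energy {d N : ℕ} {Ω : TopologicalSpace.Opens (Euc d)} (f : Euc d → Euc N → ℝ) (u : L1 Ω N) :
    EReal :=
  ((∫⁻ x in (Ω : Set (Euc d)), ENNReal.ofReal (f x (u x)) : ENNReal) : EReal)

/-- The Fenchel conjugate `f*(x, z*) = sup_z (z* · z - f(x, z))` in the second variable. -/
def fenchelConj {d N : ℕ} (f : Euc d → Euc N → ℝ) (x : Euc d) (zs : Euc N) : EReal :=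
  ⨆ z : Euc N, ((inner ℝ zs z - f x z : ℝ) : EReal)

/-- The integral over `Ω` of an extended-real function, as the integral of the positive part minus
the integral of the negative part. -/
def extIntegral {d : ℕ} (Ω : TopologicalSpace.Opens (Euc d)) (g : Euc d → EReal) : EReal :=
  ((∫⁻ x in (Ω : Set (Euc d)), (g x).toENNReal : ENNReal) : EReal) -
    ((∫⁻ x in (Ω : Set (Euc d)), (-g x).toENNReal : ENNReal) : EReal)

namespace PDO

variable {d N n : ℕ} {Ω : TopologicalSpace.Opens (Euc d)}

/-- The admissible set of the primal problem: all `u ∈ L¹(Ω; ℝᴺ)` with `𝒜 u = τ`. -/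
def feasible (A : PDO Ω N n) (τ : L1 Ω n) : Set (L1 Ω N) :=
  {u | ∃ hu : u ∈ A.op.domain, A.op ⟨u, hu⟩ = τ}

/-- The dual functional `ℛ[w] = ⟨w, τ⟩ - ∫_Ω f*(x, 𝒜* w(x)) dx`, meaningful for `w ∈ D(𝒜*)`. -/
def dualFunctional (A : PDO Ω N n) (f : Euc d → Euc N → ℝ) (τ : L1 Ω n) (w : LInfty Ω n) :
    EReal :=
  ((dualPair w τ : ℝ) : EReal) - extIntegral Ω (fun x => fenchelConj f x (A.adjoint w x))

open Classical in
/-- `J(u, q) = I_f(u) + δ(q | {τ})`. -/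
def costJ (f : Euc d → Euc N → ℝ) (τ : L1 Ω n) (u : L1 Ω N) (q : L1 Ω n) : EReal :=
  energy f u + (if q = τ then 0 else ⊤)

open Classical in
/-- The perturbation `Φ(u, p) = J(u, 𝒜 u - p)` if `u ∈ W^{𝒜,1}(Ω)`, and `∞` otherwise. -/
def perturbation (A : PDO Ω N n) (f : Euc d → Euc N → ℝ) (τ : L1 Ω n) (u : L1 Ω N)
    (p : L1 Ω n) : EReal :=
  if hu : u ∈ A.op.domain then costJ f τ u (A.op ⟨u, hu⟩ - p) else ⊤

/-- The conjugate `Φ*(u*, w*)` of the perturbation in the duality of `L¹ × L¹` and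
`L^∞ × L^∞`. -/
def perturbationConj (A : PDO Ω N n) (f : Euc d → Euc N → ℝ) (τ : L1 Ω n) (us : LInfty Ω N)
    (ws : LInfty Ω n) : EReal :=
  ⨆ (u : L1 Ω N) (p : L1 Ω n),
    (((dualPair us u + dualPair ws p : ℝ) : EReal) - A.perturbation f τ u p)

/-- The Lagrangian `L(u, w*)`, given by `-L(u, w*) = sup_p (⟨w*, p⟩ - Φ(u, p))`. -/
def lagrangian (A : PDO Ω N n) (f : Euc d → Euc N → ℝ) (τ : L1 Ω n) (u : L1 Ω N)
    (ws : LInfty Ω n) : EReal :=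
  -⨆ p : L1 Ω n, (((dualPair ws p : ℝ) : EReal) - A.perturbation f τ u p)

end PDO

end

/-!
The theorem is Fenchel–Rockafellar duality for the constraint `𝒜 u = τ`, where the closed range of
`𝒜` replaces the usual interior point condition.

*Spaces and operator.* Bounded functionals on `L¹` are integration against `L^∞` fields
(`exists_LInfty_repr`), and test functions belong to `W^{𝒜,1}(Ω)`
(`PDO.exists_isDistribImage_testFunction`), so the domain of `𝒜` is dense (`PDO.dense_domain`) and
`𝒜*` is well defined. The graph of `𝒜` is closed because the weak formulation is continuous in `L¹`
(`PDO.isClosed_graph`).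

*Integral functional.* Convexity and linear growth make `f(x, ·)` Lipschitz with the growth constant
`M`, hence `I_f` is finite, convex and `M`-Lipschitz on `L¹`. Its conjugate on `L^∞` is the integral
of the pointwise conjugate (`IsConvexIntegrand.iSup_pair_sub_realEnergy`), by a measurable selection
of near-maximizers.

*Identification of the dual problem.* For `u` in the domain, `Φ(u, p)` is finite only at
`p = 𝒜 u - τ`, so `Φ*(0, w)` is the supremum of `⟨w, 𝒜 u - τ⟩ - I_f(u)` over the domain. If
`w ∈ D(𝒜*)`, then `⟨w, 𝒜 u⟩ = ⟨𝒜* w, u⟩` and density reduces this to the conjugate of `I_f` at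
`𝒜* w`. If the supremum is finite, linear growth of `I_f` forces `w ∈ D(𝒜*)`.

*No gap and attainment.* By the open mapping theorem on the graph of `𝒜`, the set
`{(𝒜 u, r) : r > I_f(u)}` is open and convex in `im 𝒜 × ℝ`. Separating it from `(τ, inf 𝒫)` and
extending the separating functional to `L¹` yields the dual maximizer (`PDO.exists_multiplier`).
-/

/-! ### The dual of `L¹` -/

section Representation

variable {α : Type*} {m : MeasurableSpace α} {μ : Measure α}
  {E : Type*} [NormedAddCommGroup E] [InnerProductSpace ℝ E]

lemma exists_pos_memLp_two (μ : Measure α) [SigmaFinite μ] :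
    ∃ s : α → ℝ, Measurable s ∧ (∀ x, 0 < s x) ∧ MemLp s 2 μ := by
  obtain ⟨h, hpos, hmeas, hint⟩ := exists_pos_lintegral_lt_of_sigmaFinite μ one_ne_zero
  have hms : Measurable fun x => Real.sqrt (h x) := hmeas.coe_nnreal_real.sqrt
  refine ⟨fun x => Real.sqrt (h x), hms, fun x => Real.sqrt_pos.2 (by exact_mod_cast hpos x), ?_⟩
  rw [memLp_two_iff_integrable_sq hms.aestronglyMeasurable]
  have : (fun x => Real.sqrt (h x) ^ 2) = fun x => (h x : ℝ) := by
    funext x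
    exact Real.sq_sqrt (h x).coe_nonneg
  rw [this]
  refine ⟨hmeas.coe_nnreal_real.aestronglyMeasurable, ?_⟩
  rw [hasFiniteIntegral_iff_enorm]
  refine lt_of_le_of_lt (le_of_eq ?_) (hint.trans ENNReal.one_lt_top)
  refine lintegral_congr fun x => ?_
  simp

variable [CompleteSpace E]

/-- A functional on `L¹`, restricted to the subspace `s • L²` for a weight `s ∈ L²`, is represented
by some `k ∈ L²`, by the Riesz representation theorem in the Hilbert space `L²`. -/
lemma exists_memLp_two_repr (T : StrongDual ℝ (Lp E 1 μ)) {s : α → ℝ} (hs : MemLp s 2 μ) :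
    ∃ k : Lp E 2 μ, ∀ g : α → E, MemLp g 2 μ → ∀ v : Lp E 1 μ,
      v =ᵐ[μ] (fun x => s x • g x) → T v = ∫ x, inner ℝ (k x) (g x) ∂μ := by
  let J : Lp E 2 μ →L[ℝ] Lp E 1 μ :=
    (ContinuousLinearMap.lsmul ℝ ℝ : ℝ →L[ℝ] E →L[ℝ] E).holderL μ 2 2 1 hs.toLp
  refine ⟨(InnerProductSpace.toDual ℝ (Lp E 2 μ)).symm (T.comp J), fun g hg v hv => ?_⟩
  have hJ : J hg.toLp = v := by
    refine Lp.ext ?_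
    refine ((ContinuousLinearMap.lsmul ℝ ℝ : ℝ →L[ℝ] E →L[ℝ] E).coeFn_holder
      (r := 1) hs.toLp hg.toLp).trans ?_
    filter_upwards [hv, hs.coeFn_toLp, hg.coeFn_toLp] with x h1 h2 h3
    rw [h1, h2, h3]
    rfl
  have h1 : inner ℝ ((InnerProductSpace.toDual ℝ (Lp E 2 μ)).symm (T.comp J)) hg.toLp
      = T.comp J hg.toLp := InnerProductSpace.toDual_symm_apply
  rw [ContinuousLinearMap.comp_apply, hJ] at h1
  rw [← h1, L2.inner_def]
  refine integral_congr_ae ?_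
  filter_upwards [hg.coeFn_toLp] with x h3
  rw [h3]

/-- **Riesz representation** of the dual of `L¹` for a `σ`-finite measure and Hilbert-space values:
every bounded linear functional on `L¹(μ; E)` is integration against an element of `L^∞(μ; E)`. The
functional is restricted to `s • L²` for a positive weight `s ∈ L²`, where it is represented by some
`k ∈ L²`; testing with `k` itself on `{‖k‖ > ‖T‖ s}` shows that `k / s` is bounded by `‖T‖`. -/
theorem exists_LInfty_repr [SigmaFinite μ] (T : StrongDual ℝ (Lp E 1 μ)) :
    ∃ w : Lp E ⊤ μ, ∀ u : Lp E 1 μ, T u = ∫ x, inner ℝ (w x) (u x) ∂μ := by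
  obtain ⟨s, hsm, hspos, hs⟩ := exists_pos_memLp_two μ
  obtain ⟨k, hk⟩ := exists_memLp_two_repr T hs
  have hkm : StronglyMeasurable k := Lp.stronglyMeasurable k
  have hk2 : MemLp k 2 μ := Lp.memLp k
  have hbound : ∀ᵐ x ∂μ, ‖k x‖ ≤ ‖T‖ * s x := by
    let S : Set α := {x | ‖T‖ * s x < ‖k x‖}
    have hS : MeasurableSet S :=
      measurableSet_lt (hsm.const_mul _) hkm.norm.measurable
    have hg : MemLp (S.indicator k) 2 μ := hk2.indicator hS
    have hsg : MemLp (fun x => s x • S.indicator k x) 1 μ := hg.smul hs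
    have h1 := hk _ hg hsg.toLp hsg.coeFn_toLp
    have h2 : T hsg.toLp ≤ ‖T‖ * ∫ x, s x * ‖S.indicator k x‖ ∂μ := by
      refine (le_abs_self _).trans ((T.le_opNorm _).trans_eq ?_)
      rw [L1.norm_eq_integral_norm]
      congr 1
      refine integral_congr_ae ?_
      filter_upwards [hsg.coeFn_toLp] with x hx
      rw [hx, norm_smul, Real.norm_of_nonneg (hspos x).le]
    have i1 : Integrable (fun x => inner ℝ (k x) (S.indicator k x)) μ := by
      have := L2.integrable_inner (𝕜 := ℝ) k hg.toLp
      refine this.congr ?_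
      filter_upwards [hg.coeFn_toLp] with x hx
      rw [hx]
    have i2 : Integrable (fun x => ‖T‖ * (s x * ‖S.indicator k x‖)) μ := by
      refine Integrable.const_mul ?_ _
      refine (memLp_one_iff_integrable.1 hsg).norm.congr (Filter.Eventually.of_forall fun x => ?_)
      simp only [norm_smul, Real.norm_of_nonneg (hspos x).le]
    have h3 : ∫ x, (inner ℝ (k x) (S.indicator k x) - ‖T‖ * (s x * ‖S.indicator k x‖)) ∂μ ≤ 0 := by
      rw [integral_sub i1 i2, integral_const_mul]
      linarith
    have hnn : ∀ x, 0 ≤ inner ℝ (k x) (S.indicator k x) - ‖T‖ * (s x * ‖S.indicator k x‖) := by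
      intro x
      by_cases hx : x ∈ S
      · have hx' : ‖T‖ * s x < ‖k x‖ := hx
        rw [Set.indicator_of_mem hx, real_inner_self_eq_norm_sq]
        nlinarith [norm_nonneg (k x)]
      · simp [hx]
    have h4 := (integral_eq_zero_iff_of_nonneg hnn (i1.sub i2)).1
      (le_antisymm h3 (integral_nonneg hnn))
    filter_upwards [h4] with x hx
    by_contra hlt
    have hxS : x ∈ S := not_le.1 hlt
    have hx' : ‖T‖ * s x < ‖k x‖ := hxS
    simp only [Pi.zero_apply, Set.indicator_of_mem hxS, real_inner_self_eq_norm_sq] at hx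
    have : 0 ≤ ‖T‖ * s x := mul_nonneg T.opNorm_nonneg (hspos x).le
    nlinarith
  have hw : MemLp (fun x => (s x)⁻¹ • k x) ⊤ μ := by
    refine memLp_top_of_bound (hsm.inv.aestronglyMeasurable.smul hkm.aestronglyMeasurable) ‖T‖ ?_
    filter_upwards [hbound] with x hx
    rw [norm_smul, norm_inv, Real.norm_of_nonneg (hspos x).le, inv_mul_le_iff₀ (hspos x), mul_comm]
    exact hx
  refine ⟨hw.toLp, fun u => ?_⟩
  have hu : Integrable u μ := L1.integrable_coeFn u
  have hum : StronglyMeasurable u := Lp.stronglyMeasurable u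
  -- The truncations of `u` to `{‖u‖ ≤ j s²}` lie in `s • L²` and converge to `u`.
  let S : ℕ → Set α := fun j => {x | ‖u x‖ ≤ j * s x ^ 2}
  have hS : ∀ j, MeasurableSet (S j) := fun j =>
    measurableSet_le hum.norm.measurable ((hsm.pow_const 2).const_mul _)
  have hSev : ∀ x, ∀ᶠ j in Filter.atTop, x ∈ S j := by
    intro x
    obtain ⟨j₀, hj₀⟩ := exists_nat_ge (‖u x‖ / s x ^ 2)
    filter_upwards [Filter.eventually_ge_atTop j₀] with j hj
    have : ‖u x‖ / s x ^ 2 ≤ j := hj₀.trans (by exact_mod_cast hj)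
    exact (div_le_iff₀ (pow_pos (hspos x) 2)).1 this
  have huS : ∀ j, Integrable ((S j).indicator u) μ := fun j => hu.indicator (hS j)
  have hT : ∀ j, T ((memLp_one_iff_integrable.2 (huS j)).toLp) =
      ∫ x, inner ℝ ((s x)⁻¹ • k x) ((S j).indicator u x) ∂μ := by
    intro j
    have hg : MemLp (fun x => (s x)⁻¹ • (S j).indicator u x) 2 μ := by
      refine (hs.const_mul (j : ℝ)).mono
        (hsm.inv.aestronglyMeasurable.smul (huS j).aestronglyMeasurable)
        (Filter.Eventually.of_forall fun x => ?_)
      rw [norm_smul, norm_inv, Real.norm_of_nonneg (hspos x).le, inv_mul_le_iff₀ (hspos x),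
        Real.norm_of_nonneg (mul_nonneg (Nat.cast_nonneg j) (hspos x).le)]
      by_cases hx : x ∈ S j
      · rw [Set.indicator_of_mem hx]
        have : ‖u x‖ ≤ j * s x ^ 2 := hx
        linarith
      · rw [Set.indicator_of_notMem hx, norm_zero]
        exact mul_nonneg (hspos x).le (mul_nonneg (Nat.cast_nonneg j) (hspos x).le)
    rw [hk _ hg]
    · simp only [inner_smul_left, inner_smul_right]
      rfl
    · filter_upwards [(memLp_one_iff_integrable.2 (huS j)).coeFn_toLp] with x hx
      rw [hx, smul_inv_smul₀ (hspos x).ne']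
  have hlim1 : Filter.Tendsto (fun j => (memLp_one_iff_integrable.2 (huS j)).toLp)
      Filter.atTop (nhds u) := by
    rw [tendsto_iff_norm_sub_tendsto_zero]
    have h0 : (fun j => ‖(memLp_one_iff_integrable.2 (huS j)).toLp - u‖) =
        fun j => ∫ x, ‖(S j).indicator u x - u x‖ ∂μ := by
      funext j
      rw [L1.norm_eq_integral_norm]
      refine integral_congr_ae ?_
      filter_upwards [(memLp_one_iff_integrable.2 (huS j)).coeFn_toLp,
        Lp.coeFn_sub (memLp_one_iff_integrable.2 (huS j)).toLp u] with x hx hx2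
      rw [hx2, Pi.sub_apply, hx]
    rw [h0, ← integral_zero α ℝ (μ := μ)]
    refine tendsto_integral_of_dominated_convergence (fun x => ‖u x‖)
      (fun j => ((huS j).sub hu).norm.aestronglyMeasurable) hu.norm (fun j => ?_) ?_
    · refine Filter.Eventually.of_forall fun x => ?_
      by_cases hx : x ∈ S j <;> simp [hx]
    · refine Filter.Eventually.of_forall fun x => tendsto_const_nhds.congr' ?_
      filter_upwards [hSev x] with j hj
      simp [hj]
  have hlim2 : Filter.Tendsto (fun j => ∫ x, inner ℝ ((s x)⁻¹ • k x) ((S j).indicator u x) ∂μ)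
      Filter.atTop (nhds (∫ x, inner ℝ ((s x)⁻¹ • k x) (u x) ∂μ)) := by
    refine tendsto_integral_of_dominated_convergence (fun x => ‖T‖ * ‖u x‖)
      (fun j => hw.1.inner (huS j).aestronglyMeasurable) (hu.norm.const_mul _) (fun j => ?_) ?_
    · filter_upwards [hbound] with x hx
      have hx' : ‖(s x)⁻¹ • k x‖ ≤ ‖T‖ := by
        rw [norm_smul, norm_inv, Real.norm_of_nonneg (hspos x).le, inv_mul_le_iff₀ (hspos x),
          mul_comm]
        exact hx
      refine (norm_inner_le_norm _ _).trans (mul_le_mul hx' ?_ (norm_nonneg _) T.opNorm_nonneg)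
      exact norm_indicator_le_norm_self _ _
    · refine Filter.Eventually.of_forall fun x => tendsto_const_nhds.congr' ?_
      filter_upwards [hSev x] with j hj
      simp [hj]
  have h5 := tendsto_nhds_unique ((T.continuous.tendsto u).comp hlim1)
    (hlim2.congr fun j => (hT j).symm)
  rw [h5]
  refine integral_congr_ae ?_
  filter_upwards [hw.coeFn_toLp] with x hx
  rw [hx]

end Representation

/-! ### Test functions, the pairing and the domain of the operator -/

section TestFunctions

variable {d m : ℕ} {Ω : TopologicalSpace.Opens (Euc d)}

namespace IsTestFunction

lemma memLp_one {φ : Euc d → Euc m} (hφ : IsTestFunction Ω φ) :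
    MemLp φ 1 (volume.restrict (Ω : Set (Euc d))) :=
  memLp_one_iff_integrable.2
    (hφ.contDiff.continuous.integrable_of_hasCompactSupport hφ.hasCompactSupport).restrict

lemma eq_zero_of_notMem {φ : Euc d → Euc m} (hφ : IsTestFunction Ω φ) {x : Euc d} (hx : x ∉ Ω) :
    φ x = 0 :=
  image_eq_zero_of_notMem_tsupport fun h => hx (hφ.tsupport_subset h)

lemma integrable_inner_testFunction {φ ψ : Euc d → Euc m} (hφ : IsTestFunction Ω φ)
    (hψ : IsTestFunction Ω ψ) : Integrable (fun x => inner ℝ (φ x) (ψ x)) := by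
  refine (hφ.contDiff.continuous.inner hψ.contDiff.continuous).integrable_of_hasCompactSupport ?_
  refine hφ.hasCompactSupport.mono fun x hx => ?_
  contrapose! hx
  have : φ x = 0 := by simpa using hx
  simp [this]

lemma setIntegral_inner {φ ψ : Euc d → Euc m} (hφ : IsTestFunction Ω φ) :
    ∫ x in (Ω : Set (Euc d)), inner ℝ (φ x) (ψ x) = ∫ x, inner ℝ (φ x) (ψ x) :=
  setIntegral_eq_integral_of_forall_compl_eq_zero fun x hx => by
    rw [hφ.eq_zero_of_notMem hx, inner_zero_left]

lemma integral_inner_pderiv {φ η : Euc d → Euc m} (hφ : IsTestFunction Ω φ)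
    (hη : IsTestFunction Ω η) (i : Fin d) :
    ∫ x in (Ω : Set (Euc d)), inner ℝ (φ x) (_root_.pderiv i η x) =
      ∫ x in (Ω : Set (Euc d)), inner ℝ ((-1 : ℝ) • _root_.pderiv i φ x) (η x) := by
  rw [setIntegral_inner hφ, setIntegral_inner ((hφ.pderiv i).const_smul (-1))]
  have := integral_bilinear_fderiv_right_eq_neg_left_of_integrable (μ := (volume : Measure (Euc d)))
    (f := φ) (g := η) (v := EuclideanSpace.single i 1)
    (B := (innerSL ℝ : Euc m →L[ℝ] Euc m →L[ℝ] ℝ))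
    ((hφ.pderiv i).integrable_inner_testFunction hη)
    (hφ.integrable_inner_testFunction (hη.pderiv i)) (hφ.integrable_inner_testFunction hη)
    (fun x _ => (hφ.contDiff.differentiable (by simp)).differentiableAt)
    (fun x _ => (hη.contDiff.differentiable (by simp)).differentiableAt)
  refine this.trans ?_
  rw [← integral_neg]
  refine integral_congr_ae (Filter.Eventually.of_forall fun x => ?_)
  simp only [neg_smul, one_smul, inner_neg_left]
  rfl

lemma iterate_pderiv {φ : Euc d → Euc m} (hφ : IsTestFunction Ω φ) (i : Fin d) (k : ℕ) :
    IsTestFunction Ω ((_root_.pderiv i)^[k] φ) := by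
  induction k with
  | zero => exact hφ
  | succ k ih =>
    rw [Function.iterate_succ_apply']
    exact ih.pderiv i

lemma exists_adjoint_iterate_pderiv (i : Fin d) (k : ℕ) :
    ∀ {φ : Euc d → Euc m}, IsTestFunction Ω φ → ∃ ψ : Euc d → Euc m, IsTestFunction Ω ψ ∧
      ∀ η, IsTestFunction Ω η →
        ∫ x in (Ω : Set (Euc d)), inner ℝ (φ x) ((_root_.pderiv i)^[k] η x) =
          ∫ x in (Ω : Set (Euc d)), inner ℝ (ψ x) (η x) := by
  induction k with
  | zero => exact fun {φ} hφ => ⟨φ, hφ, fun η _ => rfl⟩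
  | succ k ih =>
    intro φ hφ
    obtain ⟨ψ, hψ, h⟩ := ih ((hφ.pderiv i).const_smul (-1))
    refine ⟨ψ, hψ, fun η hη => ?_⟩
    rw [← h η hη, Function.iterate_succ_apply', integral_inner_pderiv hφ (hη.iterate_pderiv i k)]

/-- Iterated integration by parts: `∂^α` has an adjoint on test functions, namely `(-1)^|α|` times
the same derivatives in reversed order (only the existence is used). -/
lemma exists_adjoint_multiDeriv {φ : Euc d → Euc m} (hφ : IsTestFunction Ω φ) (α : Fin d → ℕ) :
    ∃ ψ : Euc d → Euc m, IsTestFunction Ω ψ ∧ ∀ η, IsTestFunction Ω η →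
      ∫ x in (Ω : Set (Euc d)), inner ℝ (φ x) (_root_.multiDeriv α η x) =
        ∫ x in (Ω : Set (Euc d)), inner ℝ (ψ x) (η x) := by
  have key : ∀ (l : List (Fin d)) (φ : Euc d → Euc m), IsTestFunction Ω φ →
      ∃ ψ : Euc d → Euc m, IsTestFunction Ω ψ ∧ ∀ η : Euc d → Euc m, IsTestFunction Ω η →
        IsTestFunction Ω (l.foldr (fun i h => (_root_.pderiv i)^[α i] h) η) ∧
        ∫ x in (Ω : Set (Euc d)),
          inner ℝ (φ x) (l.foldr (fun i h => (_root_.pderiv i)^[α i] h) η x) =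
          ∫ x in (Ω : Set (Euc d)), inner ℝ (ψ x) (η x) := by
    intro l
    induction l with
    | nil => exact fun φ hφ => ⟨φ, hφ, fun η hη => ⟨hη, rfl⟩⟩
    | cons i l ih =>
      intro φ hφ
      obtain ⟨ψ₁, hψ₁, h₁⟩ := exists_adjoint_iterate_pderiv i (α i) hφ
      obtain ⟨ψ, hψ, h⟩ := ih ψ₁ hψ₁
      refine ⟨ψ, hψ, fun η hη => ⟨(h η hη).1.iterate_pderiv i _, ?_⟩⟩
      rw [List.foldr_cons, h₁ _ (h η hη).1, (h η hη).2]
  obtain ⟨ψ, hψ, h⟩ := key (List.finRange d) φ hφ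
  exact ⟨ψ, hψ, fun η hη => (h η hη).2⟩

/-- Multiplication by a matrix field that is smooth in `Ω` preserves test functions. -/
lemma mulVec {p : ℕ} {C : Euc d → Matrix (Fin p) (Fin m) ℝ}
    (hC : ∀ i j, ContDiffOn ℝ ∞ (fun x => C x i j) (Ω : Set (Euc d))) {φ : Euc d → Euc m}
    (hφ : IsTestFunction Ω φ) :
    IsTestFunction Ω (fun y => (WithLp.toLp 2 ((C y).mulVec (φ y).ofLp) : Euc p)) := by
  have hsub : tsupport (fun y => (WithLp.toLp 2 ((C y).mulVec (φ y).ofLp) : Euc p))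
      ⊆ tsupport φ := by
    refine closure_mono fun x hx => ?_
    contrapose! hx
    have hx0 : φ x = 0 := by simpa using hx
    simp [hx0]
  refine ⟨?_, hφ.hasCompactSupport.of_isClosed_subset (isClosed_tsupport _) hsub,
    hsub.trans hφ.tsupport_subset⟩
  rw [contDiff_iff_contDiffAt]
  intro x
  by_cases hx : x ∈ (Ω : Set (Euc d))
  · rw [contDiffAt_euclidean]
    intro j
    have : (fun y => (WithLp.toLp 2 ((C y).mulVec (φ y).ofLp) : Euc p) j)
        = fun y => ∑ i, C y j i * φ y i := by
      funext y
      simp [Matrix.mulVec, dotProduct]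
    rw [this]
    refine ContDiffAt.sum fun i _ => ContDiffAt.mul ?_ ?_
    · exact (hC j i).contDiffAt (Ω.isOpen.mem_nhds hx)
    · exact (contDiffAt_euclidean.1 hφ.contDiff.contDiffAt) i
  · have hx' := fun h => hx (hφ.tsupport_subset (hsub h))
    exact (contDiffAt_const (c := (0 : Euc p))).congr_of_eventuallyEq
      (notMem_tsupport_iff_eventuallyEq.1 hx')

end IsTestFunction

/-- A field in `L^∞(Ω; ℝᵐ)` that annihilates all test functions vanishes. -/
lemma eq_zero_of_forall_dualPair_eq_zero {v : LInfty Ω m}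
    (h : ∀ (φ : Euc d → Euc m) (hφ : IsTestFunction Ω φ), dualPair v hφ.memLp_one.toLp = 0) :
    v = 0 := by
  have hcomp : ∀ i : Fin m, ∀ᵐ x ∂volume, x ∈ (Ω : Set (Euc d)) → v x i = 0 := by
    intro i
    refine Ω.isOpen.ae_eq_zero_of_integral_contDiff_smul_eq_zero ?_ ?_
    · have h1 : LocallyIntegrable v (volume.restrict (Ω : Set (Euc d))) :=
        (Lp.memLp v).locallyIntegrable le_top
      have h2 : LocallyIntegrable (fun x => v x i) (volume.restrict (Ω : Set (Euc d))) := by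
        intro x
        obtain ⟨s, hs, hs'⟩ := h1 x
        exact ⟨s, hs, (EuclideanSpace.proj (𝕜 := ℝ) i).integrable_comp hs'⟩
      exact locallyIntegrableOn_of_locallyIntegrable_restrict h2
    · intro η hη hηc hηs
      have hφ : IsTestFunction Ω (fun x => η x • (EuclideanSpace.single i (1 : ℝ) : Euc m)) := by
        refine ⟨hη.smul contDiff_const, hηc.smul_right, ?_⟩
        exact (tsupport_smul_subset_left η _).trans hηs
      have h1 := h _ hφ
      rw [dualPair] at h1
      have h2 : ∫ x in (Ω : Set (Euc d)), η x • v x i = 0 := by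
        rw [← h1]
        refine integral_congr_ae ?_
        filter_upwards [hφ.memLp_one.coeFn_toLp] with x hx
        rw [hx]
        simp [inner_smul_right, EuclideanSpace.inner_single_right]
      rwa [setIntegral_eq_integral_of_forall_compl_eq_zero] at h2
      intro x hx
      have : η x = 0 := image_eq_zero_of_notMem_tsupport fun h => hx (hηs h)
      simp [this]
  refine (Lp.eq_zero_iff_ae_eq_zero).2 ?_
  rw [Filter.EventuallyEq, ae_restrict_iff' Ω.isOpen.measurableSet]
  filter_upwards [ae_all_iff.2 hcomp] with x hx hxΩ
  ext i
  exact hx i hxΩ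

end TestFunctions

section Pairing

variable {d m : ℕ} {Ω : TopologicalSpace.Opens (Euc d)}

/-- The pairing with `w ∈ L^∞` as a bounded linear functional on `L¹`. -/
noncomputable def dualPairCLM (w : LInfty Ω m) : StrongDual ℝ (L1 Ω m) :=
  (innerSL ℝ : Euc m →L[ℝ] Euc m →L[ℝ] ℝ).lpPairing
    (volume.restrict (Ω : Set (Euc d))) ⊤ 1 w

@[simp]
lemma dualPairCLM_apply (w : LInfty Ω m) (u : L1 Ω m) : dualPairCLM w u = dualPair w u :=
  ContinuousLinearMap.lpPairing_eq_integral _ w u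

lemma dualPairCLM_sub (v w : LInfty Ω m) : dualPairCLM (v - w) = dualPairCLM v - dualPairCLM w :=
  map_sub ((innerSL ℝ : Euc m →L[ℝ] Euc m →L[ℝ] ℝ).lpPairing
    (volume.restrict (Ω : Set (Euc d))) ⊤ 1) v w

@[simp]
lemma dualPair_zero_left (u : L1 Ω m) : dualPair (0 : LInfty Ω m) u = 0 := by
  have := dualPairCLM_sub (0 : LInfty Ω m) 0
  rw [sub_self, sub_self] at this
  rw [← dualPairCLM_apply, this, zero_apply]

lemma dualPair_smul_left (c : ℝ) (w : LInfty Ω m) (u : L1 Ω m) :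
    dualPair (c • w) u = c * dualPair w u := by
  have : dualPairCLM (c • w) = c • dualPairCLM w :=
    map_smul ((innerSL ℝ : Euc m →L[ℝ] Euc m →L[ℝ] ℝ).lpPairing
      (volume.restrict (Ω : Set (Euc d))) ⊤ 1) c w
  rw [← dualPairCLM_apply, this]
  simp

lemma exists_dualPair_eq (T : StrongDual ℝ (L1 Ω m)) :
    ∃ w : LInfty Ω m, ∀ u, dualPair w u = T u := by
  obtain ⟨w, hw⟩ := exists_LInfty_repr T
  exact ⟨w, fun u => (hw u).symm⟩

end Pairing

namespace PDO

variable {d N n : ℕ} {Ω : TopologicalSpace.Opens (Euc d)} (A : PDO Ω N n)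

/-- Test functions belong to the domain `W^{𝒜,1}(Ω)`: moving all derivatives onto the test function
in the weak formulation produces an image that is again a test function. -/
lemma exists_isDistribImage_testFunction {φ : Euc d → Euc N} (hφ : IsTestFunction Ω φ) :
    ∃ g : L1 Ω n, A.IsDistribImage hφ.memLp_one.toLp g := by
  choose ψ hψ hψη using fun α => hφ.exists_adjoint_multiDeriv α
  have hg : IsTestFunction Ω (fun x => ∑ α ∈ A.indices, (-1 : ℝ) ^ (∑ i, α i) •
      (WithLp.toLp 2 ((A.coeff α x).mulVec (ψ α x).ofLp) : Euc n)) :=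
    IsTestFunction.sum _ fun α hα =>
      ((hψ α).mulVec fun i j => A.smooth α hα i j).const_smul _
  refine ⟨hg.memLp_one.toLp, fun η hη => ?_⟩
  have hη' : ∀ α ∈ A.indices, IsTestFunction Ω
      (fun y => (WithLp.toLp 2 ((A.coeff α y).transpose.mulVec (η y).ofLp) : Euc N)) :=
    fun α hα => hη.mulVec fun i j => A.smooth α hα j i
  have h1 : ∫ x in (Ω : Set (Euc d)),
      inner ℝ ((hφ.memLp_one.toLp : L1 Ω N) x) (A.transpose η x) =
      ∫ x in (Ω : Set (Euc d)), ∑ α ∈ A.indices, (-1 : ℝ) ^ (∑ i, α i) *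
        inner ℝ (φ x) (multiDeriv α (fun y =>
          (WithLp.toLp 2 ((A.coeff α y).transpose.mulVec (η y).ofLp) : Euc N)) x) := by
    refine integral_congr_ae ?_
    filter_upwards [hφ.memLp_one.coeFn_toLp] with x hx
    rw [hx, transpose, inner_sum]
    simp only [inner_smul_right]
  have h2 : ∫ x in (Ω : Set (Euc d)), inner ℝ ((hg.memLp_one.toLp : L1 Ω n) x) (η x) =
      ∫ x in (Ω : Set (Euc d)), ∑ α ∈ A.indices, (-1 : ℝ) ^ (∑ i, α i) *
        inner ℝ (ψ α x)
          (WithLp.toLp 2 ((A.coeff α x).transpose.mulVec (η x).ofLp) : Euc N) := by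
    refine integral_congr_ae ?_
    filter_upwards [hg.memLp_one.coeFn_toLp] with x hx
    rw [hx, sum_inner]
    refine Finset.sum_congr rfl fun α _ => ?_
    rw [real_inner_smul_left]
    congr 1
    simp only [EuclideanSpace.inner_eq_star_dotProduct, star_trivial]
    rw [Matrix.mulVec_transpose, Matrix.dotProduct_mulVec, dotProduct_comm, dotProduct_comm]
  rw [h1, h2, integral_finsetSum, integral_finsetSum]
  · refine Finset.sum_congr rfl fun α hα => ?_
    rw [integral_const_mul, integral_const_mul, hψη α _ (hη' α hα)]
  · exact fun α hα => (((hψ α).integrable_inner_testFunction (hη' α hα)).restrict).const_mul _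
  · exact fun α hα => ((hφ.integrable_inner_testFunction
      ((hη' α hα).multiDeriv α)).restrict).const_mul _

lemma mem_domain_iff (u : L1 Ω N) : u ∈ A.op.domain ↔ ∃ g, A.IsDistribImage u g := by
  rw [LinearPMap.mem_domain_iff]
  simp only [mem_graph_op]

lemma testFunction_mem_domain {φ : Euc d → Euc N} (hφ : IsTestFunction Ω φ) :
    (hφ.memLp_one.toLp : L1 Ω N) ∈ A.op.domain :=
  (A.mem_domain_iff _).2 (A.exists_isDistribImage_testFunction hφ)

lemma eq_of_forall_mem_domain {v v' : LInfty Ω N}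
    (h : ∀ u ∈ A.op.domain, dualPair v u = dualPair v' u) : v = v' := by
  rw [← sub_eq_zero]
  refine eq_zero_of_forall_dualPair_eq_zero fun φ hφ => ?_
  rw [← dualPairCLM_apply, dualPairCLM_sub, sub_apply, dualPairCLM_apply,
    dualPairCLM_apply, h _ (A.testFunction_mem_domain hφ), sub_self]

/-- `W^{𝒜,1}(Ω)` is dense in `L¹`: an annihilating functional is given by an `L^∞` field, which
vanishes because test functions lie in the domain. -/
lemma dense_domain : Dense (A.op.domain : Set (L1 Ω N)) := by
  refine Submodule.dense_iff_topologicalClosure_eq_top.2 (Submodule.eq_top_iff'.2 fun u₀ => ?_)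
  by_contra hu₀
  obtain ⟨T, c, hTu₀, hT⟩ := geometric_hahn_banach_point_closed
    (A.op.domain.topologicalClosure.convex) (A.op.domain.isClosed_topologicalClosure) hu₀
  have hzero : ∀ u ∈ A.op.domain, T u = 0 := by
    intro u hu
    by_contra hne
    have := hT ((c / T u) • u)
      (A.op.domain.topologicalClosure.smul_mem _ (A.op.domain.le_topologicalClosure hu))
    rw [map_smul, smul_eq_mul, div_mul_cancel₀ _ hne] at this
    exact lt_irrefl _ this
  obtain ⟨v, hv⟩ := exists_dualPair_eq T
  have hv0 : v = 0 := A.eq_of_forall_mem_domain fun u hu => by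
    rw [hv, hzero u hu, dualPair_zero_left]
  have h1 := hT 0 (zero_mem _)
  rw [← hv, hv0, dualPair_zero_left] at h1 hTu₀
  exact lt_asymm h1 hTu₀

/-- The dual operator is single-valued and defined everywhere on `D(𝒜*)`. -/
lemma existsUnique_isAdjointValue {w : LInfty Ω n} (hw : w ∈ A.adjointDomain) :
    ∃! v, A.IsAdjointValue w v := by
  obtain ⟨c, -, hc⟩ := hw
  let T₀ : A.op.domain →ₗ[ℝ] ℝ := (dualPairCLM w).toLinearMap ∘ₗ A.op.toFun
  obtain ⟨T, hT, -⟩ := exists_extension_norm_eq A.op.domain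
    (T₀.mkContinuous c fun u => by
      simpa [T₀] using hc u)
  obtain ⟨v, hv⟩ := exists_dualPair_eq T
  refine ⟨v, fun u => ?_, fun v' hv' => ?_⟩
  · rw [hv, hT]
    simp [T₀]
  · refine A.eq_of_forall_mem_domain fun u hu => ?_
    rw [hv, ← hv' ⟨u, hu⟩, hT ⟨u, hu⟩]
    simp [T₀]

lemma isAdjointValue_adjoint {w : LInfty Ω n} (hw : w ∈ A.adjointDomain) :
    A.IsAdjointValue w (A.adjoint w) := by
  have h := (A.existsUnique_isAdjointValue hw).exists
  rw [adjoint, dif_pos h]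
  exact h.choose_spec

end PDO

/-! ### Measurable selection and extended integrals -/

section Selection

variable {α : Type*} [MeasurableSpace α] {E : Type*} [NormedAddCommGroup E]
  [TopologicalSpace.SeparableSpace E] [MeasurableSpace E]

/-- **Measurable selection** of near-maximizers of a Carathéodory function `φ`: there are integrable
functions `u k`, starting from `0`, along which `φ x (u k x)` increases to `sup_z φ x z` at every
point. At each step the current choice is replaced by the next point of a countable dense set where
this increases `φ`, on a set of finite measure; each point of the dense set is tried infinitely
often. -/
lemma exists_increasing_selection (μ : Measure α) [SigmaFinite μ] {φ : α → E → ℝ}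
    (hφ : Measurable fun p : α × E => φ p.1 p.2) (hφc : ∀ x, Continuous (φ x)) :
    ∃ u : ℕ → α → E, u 0 = 0 ∧ (∀ k, Measurable (u k)) ∧ (∀ k, Integrable (u k) μ) ∧
      (∀ x, Monotone fun k => φ x (u k x)) ∧
      ∀ x c, (∀ k, φ x (u k x) ≤ c) → ∀ z, φ x z ≤ c := by
  classical
  have : SecondCountableTopology E := UniformSpace.secondCountable_of_separable E
  let z : ℕ → E := fun k => TopologicalSpace.denseSeq E k.unpair.1
  let S : ℕ → Set α := spanningSets μ
  let u : ℕ → α → E := fun k => Nat.rec (fun _ => 0)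
    (fun k uk => Set.piecewise {x | x ∈ S k ∧ φ x (uk x) < φ x (z k)} (fun _ => z k) uk) k
  have hsucc : ∀ k x, u (k + 1) x =
      if x ∈ S k ∧ φ x (u k x) < φ x (z k) then z k else u k x := fun k x => by
    simp only [u, Set.piecewise, Set.mem_ofPred_eq]
  have hset : ∀ k, Measurable (u k) →
      MeasurableSet {x | x ∈ S k ∧ φ x (u k x) < φ x (z k)} := fun k hk =>
    (measurableSet_spanningSets μ k).inter (measurableSet_lt
      (hφ.comp (measurable_id.prodMk hk)) (hφ.comp (measurable_id.prodMk measurable_const)))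
  have hmeas : ∀ k, Measurable (u k) := by
    intro k
    induction k with
    | zero => exact measurable_const
    | succ k ih => exact Measurable.piecewise (hset k ih) measurable_const ih
  have hstep : ∀ x k, φ x (u k x) ≤ φ x (u (k + 1) x) := by
    intro x k
    rw [hsucc]
    split_ifs with h
    · exact h.2.le
    · exact le_rfl
  refine ⟨u, rfl, hmeas, fun k => ?_, fun x => monotone_nat_of_le_succ (hstep x),
    fun x c hc y => ?_⟩
  · induction k with
    | zero => exact integrable_zero _ _ _
    | succ k ih =>
      refine Integrable.piecewise (hset k (hmeas k)) ?_ ih.integrableOn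
      refine integrableOn_const (hs := ?_)
      exact ((measure_mono fun x hx => hx.1).trans_lt (measure_spanningSets_lt_top μ k)).ne
  · have hcl : IsClosed {y | φ x y ≤ c} := isClosed_le (hφc x) continuous_const
    have hdense : ∀ j, φ x (TopologicalSpace.denseSeq E j) ≤ c := by
      intro j
      -- The index `k` encodes the dense point `j` together with a stage at which `x ∈ S k`.
      set k := Nat.pair j (spanningSetsIndex μ x) with hk
      have hz : z k = TopologicalSpace.denseSeq E j := by simp [z, hk]
      have hxk : x ∈ S k :=
        mem_spanningSets_of_index_le μ x (Nat.right_le_pair j (spanningSetsIndex μ x))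
      have h1 := hc (k + 1)
      rw [hsucc] at h1
      rw [← hz]
      split_ifs at h1 with h
      · exact h1
      · exact (not_lt.1 fun hlt => h ⟨hxk, hlt⟩).trans h1
    have := hcl.closure_subset_iff.2 (Set.range_subset_iff.2 hdense)
    exact this (TopologicalSpace.denseRange_denseSeq E y)

end Selection

section ExtendedIntegral

lemma EReal.toENNReal_add_ofReal_eq {g : EReal} {b : ℝ} (hb : 0 ≤ b) (hg : -(b : EReal) ≤ g) :
    g.toENNReal + ENNReal.ofReal b = (g + b).toENNReal + (-g).toENNReal := by
  induction g with
  | bot => simp at hg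
  | top => simp
  | coe r =>
    have hr : -b ≤ r := by exact_mod_cast hg
    rw [← EReal.coe_add, ← EReal.coe_neg]
    simp only [EReal.toENNReal_of_ne_top (EReal.coe_ne_top _), EReal.toReal_coe]
    rcases le_total 0 r with h | h
    · rw [ENNReal.ofReal_of_nonpos (neg_nonpos.2 h), add_zero, ENNReal.ofReal_add h hb]
    · rw [ENNReal.ofReal_of_nonpos h, zero_add, ← ENNReal.ofReal_add (by linarith) (by linarith)]
      congr 1
      ring

variable {d : ℕ} {Ω : TopologicalSpace.Opens (Euc d)}

/-- Adding an integrable minorant reduces the extended integral to the integral of a nonnegative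
function. -/
lemma extIntegral_eq_lintegral_add_sub {g : Euc d → EReal}
    (hg : AEMeasurable g (volume.restrict (Ω : Set (Euc d)))) {b : Euc d → ℝ}
    (hb : IntegrableOn b (Ω : Set (Euc d))) (hb0 : ∀ x ∈ Ω, 0 ≤ b x)
    (hgb : ∀ x ∈ Ω, -(b x : EReal) ≤ g x) :
    extIntegral Ω g = ((∫⁻ x in (Ω : Set (Euc d)), (g x + b x).toENNReal : ENNReal) : EReal) -
      ((∫ x in (Ω : Set (Euc d)), b x : ℝ) : EReal) := by
  have hb0' : 0 ≤ᵐ[volume.restrict (Ω : Set (Euc d))] b :=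
    ae_restrict_of_forall_mem Ω.isOpen.measurableSet hb0
  have hB : ENNReal.ofReal (∫ x in (Ω : Set (Euc d)), b x) =
      ∫⁻ x in (Ω : Set (Euc d)), ENNReal.ofReal (b x) :=
    ofReal_integral_eq_lintegral_ofReal hb hb0'
  have hgn : AEMeasurable (fun x => (-g x).toENNReal) (volume.restrict (Ω : Set (Euc d))) :=
    (measurable_neg.comp_aemeasurable hg).ereal_toENNReal
  have hsum : (∫⁻ x in (Ω : Set (Euc d)), (g x).toENNReal) +
      ∫⁻ x in (Ω : Set (Euc d)), ENNReal.ofReal (b x) =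
      (∫⁻ x in (Ω : Set (Euc d)), (g x + b x).toENNReal) +
        ∫⁻ x in (Ω : Set (Euc d)), (-g x).toENNReal := by
    rw [← lintegral_add_left' hg.ereal_toENNReal, ← lintegral_add_right' _ hgn]
    refine setLIntegral_congr_fun Ω.isOpen.measurableSet fun x hx => ?_
    exact EReal.toENNReal_add_ofReal_eq (hb0 x hx) (hgb x hx)
  have hN : ∫⁻ x in (Ω : Set (Euc d)), (-g x).toENNReal ≠ ⊤ := by
    refine ((setLIntegral_mono' Ω.isOpen.measurableSet fun x hx => ?_).trans_lt
      (hB ▸ ENNReal.ofReal_lt_top)).ne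
    have := EReal.toENNReal_le_toENNReal (EReal.neg_le.1 (hgb x hx))
    rwa [EReal.toENNReal_of_ne_top (EReal.coe_ne_top _), EReal.toReal_coe] at this
  have hBnn : 0 ≤ ∫ x in (Ω : Set (Euc d)), b x := integral_nonneg_of_ae hb0'
  rw [extIntegral]
  rw [← hB] at hsum
  generalize (∫⁻ x in (Ω : Set (Euc d)), (g x).toENNReal) = P at hsum ⊢
  generalize (∫⁻ x in (Ω : Set (Euc d)), (g x + b x).toENNReal) = Q at hsum ⊢
  generalize (∫⁻ x in (Ω : Set (Euc d)), (-g x).toENNReal) = R at hsum hN ⊢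
  generalize (∫ x in (Ω : Set (Euc d)), b x) = B at hsum hBnn ⊢
  lift R to NNReal using hN
  induction P with
  | top =>
    have hQ : Q = ⊤ := by
      by_contra h
      rw [top_add] at hsum
      exact ENNReal.add_ne_top.2 ⟨h, ENNReal.coe_ne_top⟩ hsum.symm
    subst hQ
    rw [EReal.coe_ennreal_top, EReal.top_sub_coe]
    exact EReal.top_sub_coe _
  | coe P =>
    have hQ : Q ≠ ⊤ := by
      rintro rfl
      rw [top_add] at hsum
      exact ENNReal.add_ne_top.2 ⟨ENNReal.coe_ne_top, ENNReal.ofReal_ne_top⟩ hsum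
    lift Q to NNReal using hQ
    have h := congrArg ENNReal.toReal hsum
    rw [ENNReal.toReal_add ENNReal.coe_ne_top ENNReal.ofReal_ne_top,
      ENNReal.toReal_add ENNReal.coe_ne_top ENNReal.coe_ne_top, ENNReal.toReal_ofReal hBnn] at h
    simp only [ENNReal.coe_toReal] at h
    change ((P : ℝ) : EReal) - ((R : ℝ) : EReal) = ((Q : ℝ) : EReal) - (B : EReal)
    rw [← EReal.coe_sub, ← EReal.coe_sub, EReal.coe_eq_coe_iff]
    linarith

end ExtendedIntegral

/-! ### Convex integral functionals of linear growth -/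

/-- A nonnegative continuous integrand on `Ω × ℝᴺ` that is convex in the second variable and of
linear growth with constant `M`, and for which `f(·, 0)` is integrable. -/
structure IsConvexIntegrand {d N : ℕ} (Ω : TopologicalSpace.Opens (Euc d))
    (f : Euc d → Euc N → ℝ) (M : ℝ) : Prop where
  continuousOn : ContinuousOn (fun p : Euc d × Euc N => f p.1 p.2)
    ((Ω : Set (Euc d)) ×ˢ (Set.univ : Set (Euc N)))
  nonneg : ∀ x ∈ Ω, ∀ z, 0 ≤ f x z
  convexOn : ∀ x ∈ Ω, ConvexOn ℝ Set.univ (f x)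
  pos : 0 < M
  growth : ∀ x ∈ Ω, ∀ z, f x z ≤ M * (1 + ‖z‖)
  integrableOn_zero : IntegrableOn (fun x => f x 0) (Ω : Set (Euc d))

/-- The integral functional `I_f(u) = ∫_Ω f(x, u(x)) dx` as a real number. -/
noncomputable def realEnergy {d N : ℕ} {Ω : TopologicalSpace.Opens (Euc d)} (f : Euc d → Euc N → ℝ)
    (u : L1 Ω N) : ℝ :=
  ∫ x in (Ω : Set (Euc d)), f x (u x)

lemma neg_le_fenchelConj {d N : ℕ} (f : Euc d → Euc N → ℝ) (x : Euc d) (zs : Euc N) :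
    -(f x 0 : EReal) ≤ fenchelConj f x zs := by
  refine le_trans (le_of_eq ?_)
    (le_iSup (fun z : Euc N => ((inner ℝ zs z - f x z : ℝ) : EReal)) 0)
  simp

lemma integrableOn_pairing {d N : ℕ} {Ω : TopologicalSpace.Opens (Euc d)} (v : LInfty Ω N)
    {u : Euc d → Euc N} (hu : IntegrableOn u (Ω : Set (Euc d))) :
    IntegrableOn (fun x => inner ℝ (v x) (u x)) (Ω : Set (Euc d)) :=
  memLp_one_iff_integrable.1 ((innerSL ℝ : Euc N →L[ℝ] Euc N →L[ℝ] ℝ).memLp_of_bilin 1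
    (Lp.memLp v) (memLp_one_iff_integrable.2 hu))

lemma coe_integral_le_coe_lintegral {α : Type*} [MeasurableSpace α] {μ : Measure α} {h : α → ℝ}
    (hh : Integrable h μ) :
    ((∫ x, h x ∂μ : ℝ) : EReal) ≤ ((∫⁻ x, ENNReal.ofReal (h x) ∂μ : ENNReal) : EReal) := by
  have h1 : ∫⁻ x, ENNReal.ofReal (h x) ∂μ ≠ ⊤ := hh.lintegral_lt_top.ne
  rw [← EReal.coe_ennreal_toReal h1, EReal.coe_le_coe_iff,
    integral_eq_lintegral_pos_part_sub_lintegral_neg_part hh]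
  exact sub_le_self _ ENNReal.toReal_nonneg

namespace IsConvexIntegrand

variable {d N : ℕ} {Ω : TopologicalSpace.Opens (Euc d)} {f : Euc d → Euc N → ℝ} {M : ℝ}
  (hf : IsConvexIntegrand Ω f M)
include hf

/-- A convex function with growth `M (1 + ‖z‖)` has all its slopes bounded by `M`, as one sees by
following the ray from `z` through `z + z'` to infinity. -/
lemma apply_add_le {x : Euc d} (hx : x ∈ Ω) (z z' : Euc N) : f x (z + z') ≤ f x z + M * ‖z'‖ := by
  refine le_of_forall_pos_le_add fun ε hε => ?_
  obtain ⟨t, ht⟩ := exists_gt (max 1 (M * (1 + ‖z‖) / ε))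
  have ht1 : 1 < t := (le_max_left _ _).trans_lt ht
  have ht0 : 0 < t := zero_lt_one.trans ht1
  have htε : M * (1 + ‖z‖) < t * ε := by
    have := (le_max_right _ _).trans_lt ht
    rwa [div_lt_iff₀ hε] at this
  have hinv : t⁻¹ ≤ 1 := inv_le_one_of_one_le₀ ht1.le
  have hconv := (hf.convexOn x hx).2 (Set.mem_univ z) (Set.mem_univ (z + t • z'))
    (sub_nonneg.2 hinv) (inv_nonneg.2 ht0.le) (sub_add_cancel 1 t⁻¹)
  have hpt : (1 - t⁻¹) • z + t⁻¹ • (z + t • z') = z + z' := by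
    rw [smul_add, smul_smul, inv_mul_cancel₀ ht0.ne', one_smul, ← add_assoc, ← add_smul,
      sub_add_cancel, one_smul]
  rw [hpt, smul_eq_mul, smul_eq_mul] at hconv
  have hg : f x (z + t • z') ≤ M * (1 + (‖z‖ + t * ‖z'‖)) := by
    refine (hf.growth x hx _).trans (mul_le_mul_of_nonneg_left ?_ hf.pos.le)
    have := norm_add_le z (t • z')
    rw [norm_smul, Real.norm_of_nonneg ht0.le] at this
    linarith
  have h0 := hf.nonneg x hx z
  have h1 : t⁻¹ * f x (z + t • z') ≤ t⁻¹ * (M * (1 + ‖z‖)) + M * ‖z'‖ := by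
    refine (mul_le_mul_of_nonneg_left hg (inv_nonneg.2 ht0.le)).trans_eq ?_
    field_simp
    ring
  have h2 : t⁻¹ * (M * (1 + ‖z‖)) ≤ ε := by
    rw [inv_mul_le_iff₀ ht0]
    exact htε.le
  have h3 : 0 ≤ t⁻¹ * f x z := mul_nonneg (inv_nonneg.2 ht0.le) h0
  linarith

lemma continuous_right {x : Euc d} (hx : x ∈ Ω) : Continuous (f x) := by
  rw [← continuousOn_univ]
  exact hf.continuousOn.comp (continuous_const.prodMk continuous_id).continuousOn
    fun z _ => ⟨hx, Set.mem_univ z⟩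

/-- The integrand extended by zero outside `Ω` is jointly measurable. -/
lemma measurable_indicator : Measurable fun p : Euc d × Euc N =>
    Set.indicator (Ω : Set (Euc d)) (fun x => f x p.2) p.1 := by
  classical
  have h := hf.continuousOn.measurable_piecewise (continuousOn_const (c := (0 : ℝ)))
    (Ω.isOpen.measurableSet.prod MeasurableSet.univ)
  refine (congrArg Measurable (funext fun p => ?_)).mp h
  by_cases hp : p.1 ∈ (Ω : Set (Euc d)) <;> simp [Set.piecewise, hp]

lemma aestronglyMeasurable_comp {u : Euc d → Euc N}
    (hu : AEStronglyMeasurable u (volume.restrict (Ω : Set (Euc d)))) :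
    AEStronglyMeasurable (fun x => f x (u x)) (volume.restrict (Ω : Set (Euc d))) := by
  have h : AEMeasurable (fun x => Set.indicator (Ω : Set (Euc d)) (fun y => f y (u x)) x)
      (volume.restrict (Ω : Set (Euc d))) :=
    hf.measurable_indicator.comp_aemeasurable (aemeasurable_id.prodMk hu.aemeasurable)
  refine h.aestronglyMeasurable.congr ?_
  refine ae_restrict_of_forall_mem Ω.isOpen.measurableSet fun x hx => ?_
  simp only [Set.indicator_of_mem hx]

lemma integrable_comp {u : Euc d → Euc N} (hu : IntegrableOn u (Ω : Set (Euc d))) :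
    IntegrableOn (fun x => f x (u x)) (Ω : Set (Euc d)) := by
  refine Integrable.mono' (hf.integrableOn_zero.add (hu.norm.const_mul M))
    (hf.aestronglyMeasurable_comp hu.aestronglyMeasurable) ?_
  refine ae_restrict_of_forall_mem Ω.isOpen.measurableSet fun x hx => ?_
  rw [Real.norm_of_nonneg (hf.nonneg x hx _)]
  have := hf.apply_add_le hx 0 (u x)
  rwa [zero_add] at this

lemma integrable (u : L1 Ω N) : IntegrableOn (fun x => f x (u x)) (Ω : Set (Euc d)) :=
  hf.integrable_comp (L1.integrable_coeFn u)

lemma energy_eq (u : L1 Ω N) : energy f u = (realEnergy f u : EReal) := by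
  have h0 : 0 ≤ᵐ[volume.restrict (Ω : Set (Euc d))] fun x => f x (u x) :=
    ae_restrict_of_forall_mem Ω.isOpen.measurableSet fun x hx => hf.nonneg x hx _
  rw [energy, realEnergy, ← ofReal_integral_eq_lintegral_ofReal (hf.integrable u) h0,
    EReal.coe_ennreal_ofReal, max_eq_left (integral_nonneg_of_ae h0)]

lemma realEnergy_nonneg (u : L1 Ω N) : 0 ≤ realEnergy f u :=
  setIntegral_nonneg Ω.isOpen.measurableSet fun x hx => hf.nonneg x hx _

lemma realEnergy_add_le (u v : L1 Ω N) : realEnergy f (u + v) ≤ realEnergy f u + M * ‖v‖ := by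
  have hv : Integrable v (volume.restrict (Ω : Set (Euc d))) := L1.integrable_coeFn v
  rw [L1.norm_eq_integral_norm, ← integral_const_mul, realEnergy, realEnergy,
    ← integral_add (hf.integrable u) (hv.norm.const_mul M)]
  refine integral_mono_ae (hf.integrable _) ((hf.integrable u).add (hv.norm.const_mul M)) ?_
  filter_upwards [Lp.coeFn_add u v, ae_restrict_mem Ω.isOpen.measurableSet] with x hx hxΩ
  rw [hx]
  exact hf.apply_add_le hxΩ _ _

lemma convexOn_realEnergy : ConvexOn ℝ Set.univ (realEnergy (Ω := Ω) f) := by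
  refine ⟨convex_univ, fun u _ v _ a b ha hb hab => ?_⟩
  rw [smul_eq_mul, smul_eq_mul, realEnergy, realEnergy, realEnergy, ← integral_const_mul,
    ← integral_const_mul,
    ← integral_add ((hf.integrable u).const_mul a) ((hf.integrable v).const_mul b)]
  refine integral_mono_ae (hf.integrable _)
    (((hf.integrable u).const_mul a).add ((hf.integrable v).const_mul b)) ?_
  filter_upwards [Lp.coeFn_add (a • u) (b • v), Lp.coeFn_smul a u, Lp.coeFn_smul b v,
    ae_restrict_mem Ω.isOpen.measurableSet] with x h1 h2 h3 hx
  rw [h1, Pi.add_apply, h2, h3]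
  exact (hf.convexOn x hx).2 (Set.mem_univ _) (Set.mem_univ _) ha hb hab

lemma continuous_realEnergy : Continuous (realEnergy (Ω := Ω) f) := by
  refine (LipschitzWith.of_le_add_mul (Real.toNNReal M) fun u v => ?_).continuous
  rw [Real.coe_toNNReal _ hf.pos.le, dist_eq_norm]
  simpa using hf.realEnergy_add_le v (u - v)

/-- By continuity the supremum in the conjugate may be taken over a countable dense set. -/
lemma fenchelConj_eq_iSup_denseSeq {x : Euc d} (hx : x ∈ Ω) (zs : Euc N) :
    fenchelConj f x zs = ⨆ j : ℕ, ((inner ℝ zs (TopologicalSpace.denseSeq (Euc N) j) -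
      f x (TopologicalSpace.denseSeq (Euc N) j) : ℝ) : EReal) := by
  have hc : Continuous fun z : Euc N => ((inner ℝ zs z - f x z : ℝ) : EReal) :=
    continuous_coe_real_ereal.comp
      ((continuous_const.inner continuous_id).sub (hf.continuous_right hx))
  refine le_antisymm (iSup_le fun z => ?_) (iSup_le fun j => le_iSup
    (fun z : Euc N => ((inner ℝ zs z - f x z : ℝ) : EReal)) _)
  have hcl := isClosed_le hc (continuous_const (y := ⨆ j : ℕ,
    ((inner ℝ zs (TopologicalSpace.denseSeq (Euc N) j) -
      f x (TopologicalSpace.denseSeq (Euc N) j) : ℝ) : EReal)))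
  refine hcl.closure_subset_iff.2 (Set.range_subset_iff.2 fun j => ?_)
    (TopologicalSpace.denseRange_denseSeq (Euc N) z)
  exact le_iSup (fun j : ℕ => ((inner ℝ zs (TopologicalSpace.denseSeq (Euc N) j) -
      f x (TopologicalSpace.denseSeq (Euc N) j) : ℝ) : EReal)) j

lemma aemeasurable_fenchelConj (v : LInfty Ω N) :
    AEMeasurable (fun x => fenchelConj f x (v x)) (volume.restrict (Ω : Set (Euc d))) := by
  have h : AEMeasurable (fun x => ⨆ j : ℕ, ((inner ℝ (v x) (TopologicalSpace.denseSeq (Euc N) j) -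
      f x (TopologicalSpace.denseSeq (Euc N) j) : ℝ) : EReal))
      (volume.restrict (Ω : Set (Euc d))) := by
    refine AEMeasurable.iSup fun j => measurable_coe_real_ereal.comp_aemeasurable ?_
    refine AEMeasurable.sub ?_
      (hf.aestronglyMeasurable_comp aestronglyMeasurable_const).aemeasurable
    exact ((Lp.aestronglyMeasurable v).inner aestronglyMeasurable_const).aemeasurable
  refine h.congr (ae_restrict_of_forall_mem Ω.isOpen.measurableSet fun x hx => ?_)
  exact (hf.fenchelConj_eq_iSup_denseSeq hx _).symm

/-- **Conjugate of an integral functional**: in the duality of `L¹` and `L^∞`, the conjugate of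
`I_f` is the integral of the pointwise conjugate. Near-maximizers of the pointwise problem are
chosen measurably and monotone convergence is applied after adding the integrable function
`f(·, 0)`. -/
theorem iSup_pair_sub_realEnergy (v : LInfty Ω N) :
    ⨆ u : L1 Ω N, ((dualPair v u - realEnergy f u : ℝ) : EReal) =
      extIntegral Ω fun x => fenchelConj f x (v x) := by
  rw [extIntegral_eq_lintegral_add_sub (hf.aemeasurable_fenchelConj v) hf.integrableOn_zero
    (fun x hx => hf.nonneg x hx 0) (fun x _ => neg_le_fenchelConj f x (v x))]
  have hle : ∀ x z, ENNReal.ofReal (inner ℝ (v x) z - f x z + f x 0) ≤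
      (fenchelConj f x (v x) + (f x 0 : EReal)).toENNReal := by
    intro x z
    have h := EReal.toENNReal_le_toENNReal (add_le_add_left (le_iSup
      (fun z : Euc N => ((inner ℝ (v x) z - f x z : ℝ) : EReal)) z) (f x 0 : EReal))
    rwa [← EReal.coe_add, EReal.toENNReal_of_ne_top (EReal.coe_ne_top _), EReal.toReal_coe] at h
  have hint : ∀ u : Euc d → Euc N, IntegrableOn u (Ω : Set (Euc d)) →
      IntegrableOn (fun x => inner ℝ (v x) (u x) - f x (u x)) (Ω : Set (Euc d)) := fun u hu =>
    (integrableOn_pairing v hu).sub (hf.integrable_comp hu)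
  have hval : ∀ u : L1 Ω N, dualPair v u - realEnergy f u =
      (∫ x in (Ω : Set (Euc d)), (inner ℝ (v x) (u x) - f x (u x) + f x 0)) -
        ∫ x in (Ω : Set (Euc d)), f x 0 := by
    intro u
    rw [integral_add (hint u (L1.integrable_coeFn u)) hf.integrableOn_zero, add_sub_cancel_right,
      integral_sub (integrableOn_pairing v (L1.integrable_coeFn u)) (hf.integrable u)]
    rfl
  refine le_antisymm (iSup_le fun u => ?_) ?_
  · rw [hval, EReal.coe_sub]
    refine EReal.sub_le_sub ?_ le_rfl
    refine (coe_integral_le_coe_lintegral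
      ((hint u (L1.integrable_coeFn u)).add hf.integrableOn_zero)).trans ?_
    exact EReal.coe_ennreal_le_coe_ennreal_iff.2 (lintegral_mono fun x => hle x _)
  · -- The pointwise problem, set to zero outside `Ω` so that it is measurable everywhere.
    let φ : Euc d → Euc N → ℝ := fun x z =>
      Set.indicator (Ω : Set (Euc d)) (fun y => inner ℝ (v x) z - f y z) x
    have hφ : Measurable fun p : Euc d × Euc N => φ p.1 p.2 := by
      have hv : Measurable fun p : Euc d × Euc N => (inner ℝ (v p.1) p.2 : ℝ) :=
        ((Lp.stronglyMeasurable v).measurable.comp measurable_fst).inner measurable_snd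
      have h := (hv.indicator (measurable_fst Ω.isOpen.measurableSet)).sub hf.measurable_indicator
      refine (congrArg Measurable (funext fun p => ?_)).mp h
      by_cases hp : p.1 ∈ (Ω : Set (Euc d)) <;> simp [φ, hp]
    have hφc : ∀ x, Continuous (φ x) := by
      intro x
      by_cases hx : x ∈ (Ω : Set (Euc d))
      · simp only [φ, Set.indicator_of_mem hx]
        exact (continuous_const.inner continuous_id).sub (hf.continuous_right hx)
      · simp only [φ, Set.indicator_of_notMem hx]
        exact continuous_const
    obtain ⟨u, hu0, -, hui, hmono, hsup⟩ :=
      exists_increasing_selection (volume.restrict (Ω : Set (Euc d))) hφ hφc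
    have hφΩ : ∀ x ∈ Ω, ∀ z, φ x z = inner ℝ (v x) z - f x z := fun x hx z =>
      Set.indicator_of_mem (s := (Ω : Set (Euc d))) hx _
    have hnn : ∀ k, ∀ x ∈ Ω, 0 ≤ inner ℝ (v x) (u k x) - f x (u k x) + f x 0 := by
      intro k x hx
      have h := hmono x (Nat.zero_le k)
      simp only [hφΩ x hx, hu0, Pi.zero_apply, inner_zero_right, zero_sub] at h
      linarith
    have hF : ∫⁻ x in (Ω : Set (Euc d)), (fenchelConj f x (v x) + (f x 0 : EReal)).toENNReal =
        ⨆ k, ∫⁻ x in (Ω : Set (Euc d)),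
          ENNReal.ofReal (inner ℝ (v x) (u k x) - f x (u k x) + f x 0) := by
      rw [← lintegral_iSup']
      · refine setLIntegral_congr_fun Ω.isOpen.measurableSet fun x hx => ?_
        refine le_antisymm ?_ (iSup_le fun k => hle x _)
        rcases eq_or_ne (⨆ k, ENNReal.ofReal (inner ℝ (v x) (u k x) - f x (u k x) + f x 0)) ⊤
          with h | h
        · exact le_top.trans_eq h.symm
        · have hz : ∀ z, inner ℝ (v x) z - f x z ≤
              (⨆ k, ENNReal.ofReal (inner ℝ (v x) (u k x) - f x (u k x) + f x 0)).toReal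
                - f x 0 := by
            intro z
            rw [← hφΩ x hx]
            refine hsup x _ (fun k => ?_) z
            rw [hφΩ x hx, le_sub_iff_add_le]
            exact (ENNReal.ofReal_le_iff_le_toReal h).1 (le_iSup (fun k =>
              ENNReal.ofReal (inner ℝ (v x) (u k x) - f x (u k x) + f x 0)) k)
          have h1 : fenchelConj f x (v x) + (f x 0 : EReal) ≤
              ((⨆ k, ENNReal.ofReal (inner ℝ (v x) (u k x) - f x (u k x) + f x 0)).toReal :
                EReal) := by
            have h2 : fenchelConj f x (v x) ≤ _ := iSup_le fun z => EReal.coe_le_coe_iff.2 (hz z)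
            refine (add_le_add_left h2 _).trans ?_
            rw [← EReal.coe_add, sub_add_cancel]
          refine (EReal.toENNReal_le_toENNReal h1).trans ?_
          rw [EReal.toENNReal_of_ne_top (EReal.coe_ne_top _), EReal.toReal_coe,
            ENNReal.ofReal_toReal h]
      · exact fun k => ((hint _ (hui k)).add
          hf.integrableOn_zero).aestronglyMeasurable.aemeasurable.ennreal_ofReal
      · refine ae_restrict_of_forall_mem Ω.isOpen.measurableSet fun x hx k l hkl => ?_
        refine ENNReal.ofReal_le_ofReal (add_le_add_left ?_ _)
        have := hmono x hkl
        simpa only [hφΩ x hx] using this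
    rw [EReal.sub_le_iff_le_add (Or.inl (EReal.coe_ne_bot _)) (Or.inl (EReal.coe_ne_top _)), hF]
    have hk : ∀ k, ((∫⁻ x in (Ω : Set (Euc d)),
        ENNReal.ofReal (inner ℝ (v x) (u k x) - f x (u k x) + f x 0) : ENNReal) : EReal) ≤
        (⨆ u : L1 Ω N, ((dualPair v u - realEnergy f u : ℝ) : EReal)) +
          ((∫ x in (Ω : Set (Euc d)), f x 0 : ℝ) : EReal) := by
      intro k
      have hnn' : 0 ≤ᵐ[volume.restrict (Ω : Set (Euc d))]
          fun x => inner ℝ (v x) (u k x) - f x (u k x) + f x 0 :=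
        ae_restrict_of_forall_mem Ω.isOpen.measurableSet (hnn k)
      have hmem := memLp_one_iff_integrable.2 (hui k)
      have hI : IntegrableOn (fun x => inner ℝ (v x) (u k x) - f x (u k x) + f x 0)
          (Ω : Set (Euc d)) := (hint _ (hui k)).add hf.integrableOn_zero
      rw [← ofReal_integral_eq_lintegral_ofReal hI hnn',
        EReal.coe_ennreal_ofReal, max_eq_left (integral_nonneg_of_ae hnn')]
      have h := le_iSup (fun u : L1 Ω N => ((dualPair v u - realEnergy f u : ℝ) : EReal)) hmem.toLp
      refine le_trans (le_of_eq ?_) (add_le_add_left h _)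
      rw [hval, ← EReal.coe_add, sub_add_cancel, EReal.coe_eq_coe_iff]
      refine integral_congr_ae ?_
      filter_upwards [hmem.coeFn_toLp] with x hx
      rw [hx]
    have hR := (EReal.coe_ennreal_nonneg _).trans (hk 0)
    rw [← EReal.coe_toENNReal hR, EReal.coe_ennreal_le_coe_ennreal_iff]
    refine iSup_le fun k => ?_
    rw [← EReal.coe_ennreal_le_coe_ennreal_iff, EReal.coe_toENNReal hR]
    exact hk k

end IsConvexIntegrand

/-! ### Perturbation, Lagrangian and dual problem -/

lemma EReal.iSup_coe_sub_const {ι : Sort*} (a : ι → ℝ) (t : ℝ) :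
    ⨆ i, ((a i - t : ℝ) : EReal) = (⨆ i, (a i : EReal)) - (t : EReal) := by
  refine le_antisymm (iSup_le fun i => ?_) ?_
  · rw [EReal.coe_sub]
    exact EReal.sub_le_sub (le_iSup (fun i => (a i : EReal)) i) le_rfl
  · rw [EReal.sub_le_iff_le_add (Or.inl (EReal.coe_ne_bot _)) (Or.inl (EReal.coe_ne_top _))]
    refine iSup_le fun i => ?_
    refine le_trans (le_of_eq ?_) (add_le_add_left (le_iSup (fun i => ((a i - t : ℝ) : EReal)) i) _)
    rw [← EReal.coe_add]
    simp

lemma EReal.neg_iSup {ι : Sort*} (a : ι → EReal) : -⨆ i, a i = ⨅ i, -a i :=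
  EReal.negOrderIso.map_iSup a

namespace PDO

variable {d N n : ℕ} {Ω : TopologicalSpace.Opens (Euc d)} (A : PDO Ω N n)
  {f : Euc d → Euc N → ℝ} {M : ℝ} {τ : L1 Ω n}

section Perturbation

lemma perturbation_of_notMem {u : L1 Ω N} (hu : u ∉ A.op.domain) (p : L1 Ω n) :
    A.perturbation f τ u p = ⊤ := by
  rw [perturbation, dif_neg hu]

lemma energy_nonneg (u : L1 Ω N) : 0 ≤ energy f u := EReal.coe_ennreal_nonneg _

lemma perturbation_of_ne (u : A.op.domain) {p : L1 Ω n} (h : A.op u - p ≠ τ) :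
    A.perturbation f τ u p = ⊤ := by
  rw [perturbation, dif_pos u.2, costJ, if_neg h]
  exact EReal.add_top_of_ne_bot (lt_of_lt_of_le EReal.bot_lt_zero (energy_nonneg _)).ne'

lemma perturbation_of_eq (u : A.op.domain) {p : L1 Ω n} (h : A.op u - p = τ) :
    A.perturbation f τ u p = energy f (u : L1 Ω N) := by
  rw [perturbation, dif_pos u.2, costJ, if_pos h, add_zero]

open Classical in
lemma perturbation_zero_right (u : L1 Ω N) :
    A.perturbation f τ u 0 = if u ∈ A.feasible τ then energy f u else ⊤ := by
  by_cases hu : u ∈ A.op.domain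
  · by_cases h : A.op ⟨u, hu⟩ = τ
    · rw [if_pos ⟨hu, h⟩]
      exact A.perturbation_of_eq ⟨u, hu⟩ (by rw [sub_zero, h])
    · rw [if_neg fun h' => h h'.2]
      exact A.perturbation_of_ne ⟨u, hu⟩ (by rwa [sub_zero])
  · rw [if_neg fun h' => hu h'.1, A.perturbation_of_notMem hu]

/-- Only `p = 𝒜 u - τ` contributes to the supremum that defines the Lagrangian. -/
lemma lagrangian_of_mem (hf : IsConvexIntegrand Ω f M) (u : A.op.domain) (w : LInfty Ω n) :
    A.lagrangian f τ u w =
      ((realEnergy f (u : L1 Ω N) - dualPair w (A.op u - τ) : ℝ) : EReal) := by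
  have h : ⨆ p : L1 Ω n, (((dualPair w p : ℝ) : EReal) - A.perturbation f τ u p) =
      ((dualPair w (A.op u - τ) - realEnergy f (u : L1 Ω N) : ℝ) : EReal) := by
    refine le_antisymm (iSup_le fun p => ?_) ?_
    · by_cases hp : A.op u - p = τ
      · rw [A.perturbation_of_eq u hp, hf.energy_eq, ← EReal.coe_sub, ← hp, sub_sub_cancel]
      · rw [A.perturbation_of_ne u hp, EReal.sub_top]
        exact bot_le
    · refine le_trans (le_of_eq ?_) (le_iSup (fun p : L1 Ω n =>
        (((dualPair w p : ℝ) : EReal) - A.perturbation f τ u p)) (A.op u - τ))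
      rw [A.perturbation_of_eq u (sub_sub_cancel _ _), hf.energy_eq, ← EReal.coe_sub]
  rw [lagrangian, h, ← EReal.coe_neg, neg_sub]

lemma lagrangian_of_notMem {u : L1 Ω N} (hu : u ∉ A.op.domain) (w : LInfty Ω n) :
    A.lagrangian f τ u w = ⊤ := by
  simp [lagrangian, A.perturbation_of_notMem hu]

lemma iInf_lagrangian (w : LInfty Ω n) :
    ⨅ u : L1 Ω N, A.lagrangian f τ u w = -A.perturbationConj f τ 0 w := by
  simp only [lagrangian, perturbationConj, dualPair_zero_left, zero_add, EReal.neg_iSup]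

lemma iSup_lagrangian (hf : IsConvexIntegrand Ω f M) (u : L1 Ω N) :
    ⨆ w : LInfty Ω n, A.lagrangian f τ u w = A.perturbation f τ u 0 := by
  by_cases hu : u ∈ A.op.domain
  · lift u to A.op.domain using hu
    simp only [A.lagrangian_of_mem hf]
    by_cases h : A.op u - τ = 0
    · rw [A.perturbation_of_eq u (by rw [sub_zero, sub_eq_zero.1 h]), hf.energy_eq, h]
      simp [← dualPairCLM_apply]
    · rw [A.perturbation_of_ne u (by rwa [sub_zero, ne_eq, ← sub_eq_zero]),
        EReal.eq_top_iff_forall_lt]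
      intro y
      -- Multiples of a functional norming `𝒜 u - τ` make the Lagrangian arbitrarily large.
      obtain ⟨T, -, hT⟩ := exists_dual_vector ℝ (A.op u - τ) (norm_ne_zero_iff.2 h)
      obtain ⟨w, hw⟩ := exists_dualPair_eq T
      have hpos : 0 < ‖A.op u - τ‖ := norm_pos_iff.2 h
      refine lt_of_lt_of_le ?_ (le_iSup (fun w : LInfty Ω n =>
        ((realEnergy f (u : L1 Ω N) - dualPair w (A.op u - τ) : ℝ) : EReal))
          ((-((|y| + 1) / ‖A.op u - τ‖)) • w))
      rw [EReal.coe_lt_coe_iff, dualPair_smul_left, hw, hT]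
      simp only [RCLike.ofReal_real_eq_id, id_eq, neg_mul, sub_neg_eq_add]
      rw [div_mul_cancel₀ _ hpos.ne']
      have := hf.realEnergy_nonneg (u : L1 Ω N)
      linarith [le_abs_self y]
  · simp [A.lagrangian_of_notMem hu, A.perturbation_of_notMem hu]

lemma perturbationConj_zero_left (hf : IsConvexIntegrand Ω f M) (w : LInfty Ω n) :
    A.perturbationConj f τ 0 w = ⨆ u : A.op.domain,
      ((dualPair w (A.op u - τ) - realEnergy f (u : L1 Ω N) : ℝ) : EReal) := by
  rw [← neg_inj, ← iInf_lagrangian, EReal.neg_iSup]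
  refine le_antisymm (le_iInf fun u => ?_) (le_iInf fun u => ?_)
  · refine (iInf_le _ (u : L1 Ω N)).trans_eq ?_
    rw [A.lagrangian_of_mem hf, ← EReal.coe_neg, neg_sub]
  · by_cases hu : u ∈ A.op.domain
    · refine (iInf_le _ ⟨u, hu⟩).trans_eq ?_
      rw [A.lagrangian_of_mem hf ⟨u, hu⟩, ← EReal.coe_neg, neg_sub]
    · rw [A.lagrangian_of_notMem hu]
      exact le_top

end Perturbation

section Conjugate

lemma dualPair_sub_right {m : ℕ} (w : LInfty Ω m) (u v : L1 Ω m) :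
    dualPair w (u - v) = dualPair w u - dualPair w v := by
  simp only [← dualPairCLM_apply, map_sub]

/-- If `Φ*(0, w)` is finite then `w ∈ D(𝒜*)`: as `I_f` grows at most linearly, replacing `u` by
large multiples of `u` turns the upper bound into `⟨w, 𝒜 u⟩ ≤ M ‖u‖`. -/
lemma mem_adjointDomain_of_bound (hf : IsConvexIntegrand Ω f M) {w : LInfty Ω n} {K : ℝ}
    (hK : ∀ u : A.op.domain, dualPair w (A.op u - τ) - realEnergy f (u : L1 Ω N) ≤ K) :
    w ∈ A.adjointDomain := by
  have key : ∀ u : A.op.domain, dualPair w (A.op u) ≤ M * ‖(u : L1 Ω N)‖ := by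
    intro u
    by_contra! hlt
    obtain ⟨t, ht⟩ := exists_nat_gt ((K + dualPair w τ + realEnergy f (0 : L1 Ω N)) /
      (dualPair w (A.op u) - M * ‖(u : L1 Ω N)‖))
    rw [div_lt_iff₀ (sub_pos.2 hlt)] at ht
    have h1 := hK ((t : ℝ) • u)
    have h2 := hf.realEnergy_add_le 0 ((t : ℝ) • (u : L1 Ω N))
    rw [zero_add, norm_smul, Real.norm_of_nonneg (Nat.cast_nonneg t)] at h2
    rw [LinearPMap.map_smul, dualPair_sub_right, ← dualPairCLM_apply w ((t : ℝ) • _), map_smul,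
      dualPairCLM_apply, smul_eq_mul, Submodule.coe_smul] at h1
    linarith
  refine ⟨M, hf.pos, fun u => abs_le.2 ⟨?_, key u⟩⟩
  have h := key (-u)
  rw [LinearPMap.map_neg, ← dualPairCLM_apply, map_neg, dualPairCLM_apply, Submodule.coe_neg,
    norm_neg] at h
  linarith

lemma iSup_domain_pair_sub_realEnergy (hf : IsConvexIntegrand Ω f M) (v : LInfty Ω N) :
    ⨆ u : A.op.domain, ((dualPair v u - realEnergy f (u : L1 Ω N) : ℝ) : EReal) =
      ⨆ u : L1 Ω N, ((dualPair v u - realEnergy f u : ℝ) : EReal) := by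
  refine le_antisymm (iSup_le fun u => le_iSup
    (fun u : L1 Ω N => ((dualPair v u - realEnergy f u : ℝ) : EReal)) u) (iSup_le fun u => ?_)
  have hc : Continuous fun u : L1 Ω N => ((dualPair v u - realEnergy f u : ℝ) : EReal) := by
    simp only [← dualPairCLM_apply]
    exact continuous_coe_real_ereal.comp ((dualPairCLM v).continuous.sub hf.continuous_realEnergy)
  have hcl := isClosed_le hc (continuous_const (y := ⨆ u : A.op.domain,
    ((dualPair v u - realEnergy f (u : L1 Ω N) : ℝ) : EReal)))
  exact hcl.closure_subset_iff.2 (fun u hu => le_iSup (fun u : A.op.domain =>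
    ((dualPair v u - realEnergy f (u : L1 Ω N) : ℝ) : EReal)) ⟨u, hu⟩) (A.dense_domain u)

lemma neg_perturbationConj_of_mem (hf : IsConvexIntegrand Ω f M) {w : LInfty Ω n}
    (hw : w ∈ A.adjointDomain) : -A.perturbationConj f τ 0 w = A.dualFunctional f τ w := by
  have h : ∀ u : A.op.domain, dualPair w (A.op u - τ) - realEnergy f (u : L1 Ω N) =
      dualPair (A.adjoint w) u - realEnergy f (u : L1 Ω N) - dualPair w τ := by
    intro u
    rw [dualPair_sub_right, A.isAdjointValue_adjoint hw u]
    ring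
  simp only [A.perturbationConj_zero_left hf, h]
  rw [EReal.iSup_coe_sub_const, A.iSup_domain_pair_sub_realEnergy hf, hf.iSup_pair_sub_realEnergy,
    EReal.neg_sub (Or.inr (EReal.coe_ne_bot _)) (Or.inr (EReal.coe_ne_top _)), add_comm,
    ← sub_eq_add_neg, dualFunctional]

lemma perturbationConj_of_notMem (hf : IsConvexIntegrand Ω f M) {w : LInfty Ω n}
    (hw : w ∉ A.adjointDomain) : A.perturbationConj f τ 0 w = ⊤ := by
  by_contra hne
  rw [A.perturbationConj_zero_left hf] at hne
  set s := ⨆ u : A.op.domain,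
    ((dualPair w (A.op u - τ) - realEnergy f (u : L1 Ω N) : ℝ) : EReal) with hs
  refine hw (A.mem_adjointDomain_of_bound (τ := τ) (K := s.toReal) hf fun u => ?_)
  have h : ((dualPair w (A.op u - τ) - realEnergy f (u : L1 Ω N) : ℝ) : EReal) ≤ s :=
    le_iSup (fun u : A.op.domain =>
      ((dualPair w (A.op u - τ) - realEnergy f (u : L1 Ω N) : ℝ) : EReal)) u
  exact EReal.coe_le_coe_iff.1 (h.trans (EReal.le_coe_toReal hne))

end Conjugate

section ClosedRange

lemma exists_integral_inner_testFunction_eq {m : ℕ} {ψ : Euc d → Euc m}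
    (hψ : IsTestFunction Ω ψ) : ∃ T : StrongDual ℝ (L1 Ω m), ∀ u : L1 Ω m,
      T u = ∫ x in (Ω : Set (Euc d)), inner ℝ (u x) (ψ x) := by
  obtain ⟨C, hC⟩ := hψ.hasCompactSupport.exists_bound_of_continuous hψ.contDiff.continuous
  have hmem : MemLp ψ ⊤ (volume.restrict (Ω : Set (Euc d))) :=
    memLp_top_of_bound hψ.contDiff.continuous.aestronglyMeasurable C
      (Filter.Eventually.of_forall hC)
  refine ⟨dualPairCLM hmem.toLp, fun u => ?_⟩
  rw [dualPairCLM_apply, dualPair]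
  refine integral_congr_ae ?_
  filter_upwards [hmem.coeFn_toLp] with x hx
  rw [hx, real_inner_comm]

/-- Distributional differential operators are closed. -/
lemma isClosed_graph : IsClosed (A.op.graph : Set (L1 Ω N × L1 Ω n)) := by
  have h : (A.op.graph : Set (L1 Ω N × L1 Ω n)) = ⋂ (φ : Euc d → Euc n) (_ : IsTestFunction Ω φ),
      {p : L1 Ω N × L1 Ω n | ∫ x in (Ω : Set (Euc d)), inner ℝ (p.1 x) (A.transpose φ x) =
        ∫ x in (Ω : Set (Euc d)), inner ℝ (p.2 x) (φ x)} := by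
    ext ⟨u, g⟩
    simp only [SetLike.mem_coe, mem_graph_op, IsDistribImage, Set.mem_iInter, Set.mem_ofPred_eq]
  rw [h]
  refine isClosed_iInter fun φ => isClosed_iInter fun hφ => ?_
  obtain ⟨T₁, h₁⟩ := exists_integral_inner_testFunction_eq (A.isTestFunction_transpose hφ)
  obtain ⟨T₂, h₂⟩ := exists_integral_inner_testFunction_eq hφ
  simp only [← h₁, ← h₂]
  exact isClosed_eq (T₁.continuous.comp continuous_fst) (T₂.continuous.comp continuous_snd)

/-- **Existence of a multiplier.** Since `im 𝒜` is closed, the projection of the graph of `𝒜` onto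
`im 𝒜` is an open map, so `{(𝒜 u, r) : r > I_f(u)}` is an open convex subset of `im 𝒜 × ℝ`. It does
not contain `(τ, α)` for a lower bound `α` of the primal problem, and a separating hyperplane, which
is not vertical because `τ ∈ im 𝒜`, yields `w`. -/
theorem exists_multiplier (hf : IsConvexIntegrand Ω f M)
    (hclosed : IsClosed (LinearMap.range A.op.toFun : Set (L1 Ω n)))
    (hτ : τ ∈ LinearMap.range A.op.toFun) {α : ℝ}
    (hα : ∀ u : A.op.domain, A.op u = τ → α ≤ realEnergy f (u : L1 Ω N)) :
    ∃ w : LInfty Ω n, ∀ u : A.op.domain,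
      dualPair w (A.op u - τ) - realEnergy f (u : L1 Ω N) ≤ -α := by
  let G : Submodule ℝ (L1 Ω N × L1 Ω n) := A.op.graph
  let X : Submodule ℝ (L1 Ω n) := LinearMap.range A.op.toFun
  have : CompleteSpace G := A.isClosed_graph.completeSpace_coe
  have : CompleteSpace X := hclosed.completeSpace_coe
  have hGX : ∀ g : G, (g : L1 Ω N × L1 Ω n).2 ∈ X := by
    rintro ⟨g, hg⟩
    obtain ⟨u, -, hu⟩ := A.op.mem_graph_iff.1 hg
    exact ⟨u, hu⟩
  let π : G →L[ℝ] X :=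
    ((ContinuousLinearMap.snd ℝ (L1 Ω N) (L1 Ω n)).comp G.subtypeL).codRestrict X hGX
  have hπ : Function.Surjective π := by
    rintro ⟨q, u, rfl⟩
    exact ⟨⟨((u : L1 Ω N), A.op u), A.op.mem_graph u⟩, rfl⟩
  let S : Set (G × ℝ) := {p | p.1 ∈ Set.univ ∧ realEnergy f (p.1 : L1 Ω N × L1 Ω n).1 < p.2}
  have hSconv : Convex ℝ S :=
    (hf.convexOn_realEnergy.comp_linearMap
      ((LinearMap.fst ℝ (L1 Ω N) (L1 Ω n)).comp G.subtype)).convex_strict_epigraph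
  have hSopen : IsOpen S := by
    have hS : S = {p | realEnergy f (p.1 : L1 Ω N × L1 Ω n).1 < p.2} := by
      ext p
      exact ⟨fun h => h.2, fun h => ⟨Set.mem_univ _, h⟩⟩
    rw [hS]
    exact isOpen_lt (hf.continuous_realEnergy.comp
      (continuous_fst.comp (continuous_subtype_val.comp continuous_fst))) continuous_snd
  let P : G × ℝ →L[ℝ] X × ℝ := π.prodMap (ContinuousLinearMap.id ℝ ℝ)
  have hPopen : IsOpenMap P := (π.isOpenMap hπ).prodMap IsOpenMap.id
  have hnot : ((⟨τ, hτ⟩, α) : X × ℝ) ∉ P '' S := by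
    rintro ⟨⟨⟨g, hg⟩, r⟩, ⟨-, hr⟩, hP⟩
    obtain ⟨u, hu1, hu2⟩ := A.op.mem_graph_iff.1 hg
    have h1 : g.2 = τ := congrArg (fun p : X × ℝ => (p.1 : L1 Ω n)) hP
    have h2 : r = α := congrArg Prod.snd hP
    have h3 := hα u (hu2.trans h1)
    rw [hu1, ← h2] at h3
    exact absurd hr (not_lt.2 h3)
  obtain ⟨F, hF⟩ := geometric_hahn_banach_open_point (hSconv.linear_image P.toLinearMap)
    (hPopen S hSopen) hnot
  let ℓ : StrongDual ℝ X := F.comp (ContinuousLinearMap.inl ℝ X ℝ)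
  let c : ℝ := F (0, 1)
  have hFdec : ∀ q r, F (q, r) = ℓ q + r * c := by
    intro q r
    have : ((q, r) : X × ℝ) = (q, 0) + r • (0, 1) := by simp
    rw [this, map_add, map_smul]
    rfl
  have hsep : ∀ (u : A.op.domain) (r : ℝ), realEnergy f (u : L1 Ω N) < r →
      ℓ ⟨A.op u, u, rfl⟩ + r * c < ℓ ⟨τ, hτ⟩ + α * c := by
    intro u r hr
    rw [← hFdec, ← hFdec]
    exact hF _ ⟨(⟨((u : L1 Ω N), A.op u), A.op.mem_graph u⟩, r), ⟨Set.mem_univ _, hr⟩, rfl⟩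
  have hc : c < 0 := by
    obtain ⟨u, hu⟩ := hτ
    have h1 := hsep u (realEnergy f (u : L1 Ω N) + 1) (lt_add_one _)
    have h2 := hα u hu
    have h3 : (⟨A.op u, u, rfl⟩ : X) = ⟨τ, u, hu⟩ := Subtype.ext hu
    rw [h3] at h1
    nlinarith
  have hc0 : -c ≠ 0 := (neg_pos.2 hc).ne'
  obtain ⟨T, hT, -⟩ := exists_extension_norm_eq X ((-c)⁻¹ • ℓ)
  obtain ⟨w, hw⟩ := exists_dualPair_eq T
  refine ⟨w, fun u => ?_⟩
  have hle : ℓ ⟨A.op u, u, rfl⟩ + realEnergy f (u : L1 Ω N) * c ≤ ℓ ⟨τ, hτ⟩ + α * c := by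
    refine le_of_forall_pos_lt_add fun ε hε => ?_
    have h := hsep u (realEnergy f (u : L1 Ω N) + ε / (-c))
      (lt_add_of_pos_right _ (div_pos hε (neg_pos.2 hc)))
    have h' : ε / (-c) * c = -ε := by
      linear_combination -(div_mul_cancel₀ ε hc0)
    rw [add_mul, h'] at h
    linarith
  rw [dualPair_sub_right, hw, hw, hT ⟨A.op u, u, rfl⟩, hT ⟨τ, hτ⟩]
  simp only [smul_apply, smul_eq_mul]
  have hc' : 0 < (-c)⁻¹ := inv_pos.2 (neg_pos.2 hc)
  have h1 := mul_le_mul_of_nonneg_left hle hc'.le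
  have h2 : (-c)⁻¹ * c = -1 := by linear_combination -(inv_mul_cancel₀ hc0)
  have h3 : (-c)⁻¹ * (ℓ ⟨A.op u, u, rfl⟩ + realEnergy f (u : L1 Ω N) * c) =
      (-c)⁻¹ * ℓ ⟨A.op u, u, rfl⟩ - realEnergy f (u : L1 Ω N) := by
    linear_combination realEnergy f (u : L1 Ω N) * h2
  have h4 : (-c)⁻¹ * (ℓ ⟨τ, hτ⟩ + α * c) = (-c)⁻¹ * ℓ ⟨τ, hτ⟩ - α := by
    linear_combination α * h2
  rw [h3, h4] at h1
  linarith

end ClosedRange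

section Duality

lemma dualFunctional_le_energy (hf : IsConvexIntegrand Ω f M) {w : LInfty Ω n}
    (hw : w ∈ A.adjointDomain) {u : L1 Ω N} (hu : u ∈ A.feasible τ) :
    A.dualFunctional f τ w ≤ energy f u := by
  obtain ⟨hu, rfl⟩ := hu
  rw [← A.neg_perturbationConj_of_mem hf hw, EReal.neg_le, A.perturbationConj_zero_left hf,
    hf.energy_eq]
  refine le_trans (le_of_eq ?_) (le_iSup (fun u' : A.op.domain =>
    ((dualPair w (A.op u' - A.op ⟨u, hu⟩) - realEnergy f (u' : L1 Ω N) : ℝ) : EReal)) ⟨u, hu⟩)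
  simp [← dualPairCLM_apply]

/-- Under the closed range assumption some dual field reaches the value of the primal problem. -/
lemma exists_iInf_energy_le_dualFunctional (hf : IsConvexIntegrand Ω f M)
    (hclosed : IsClosed (LinearMap.range A.op.toFun : Set (L1 Ω n)))
    (hτ : τ ∈ LinearMap.range A.op.toFun) :
    ∃ w ∈ A.adjointDomain, ⨅ u ∈ A.feasible τ, energy f u ≤ A.dualFunctional f τ w := by
  set P : EReal := ⨅ u ∈ A.feasible τ, energy f u with hP
  have hle : ∀ u ∈ A.feasible τ, P ≤ realEnergy f u := fun u hu =>
    (iInf₂_le u hu).trans_eq (hf.energy_eq u)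
  have hbot : P ≠ ⊥ := (lt_of_lt_of_le EReal.bot_lt_zero
    (le_iInf₂ fun u _ => energy_nonneg u)).ne'
  have htop : P ≠ ⊤ := by
    obtain ⟨u, hu⟩ := hτ
    exact ((hle u ⟨u.2, hu⟩).trans_lt (EReal.coe_lt_top _)).ne
  have hPr : ((P.toReal : ℝ) : EReal) = P := EReal.coe_toReal htop hbot
  obtain ⟨w, hw⟩ := A.exists_multiplier (α := P.toReal) hf hclosed hτ fun u hu => by
    rw [← EReal.coe_le_coe_iff, hPr]
    exact hle u ⟨u.2, hu⟩
  have hwD : w ∈ A.adjointDomain := A.mem_adjointDomain_of_bound hf hw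
  refine ⟨w, hwD, ?_⟩
  rw [← A.neg_perturbationConj_of_mem hf hwD, ← EReal.le_neg, A.perturbationConj_zero_left hf]
  refine iSup_le fun u => ?_
  rw [← hPr, ← EReal.coe_neg, EReal.coe_le_coe_iff]
  exact hw u

end Duality

end PDO

/-! ### The duality theorem -/

open Classical in
theorem theorem1p1 {d N n : ℕ} (Ω : TopologicalSpace.Opens (Euc d)) (A : PDO Ω N n)
    -- the integrand: continuous, nonnegative, convex in `z`, of linear growth and coercive
    (f : Euc d → Euc N → ℝ)
    (hf_cont : ContinuousOn (fun p : Euc d × Euc N => f p.1 p.2)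
      ((Ω : Set (Euc d)) ×ˢ (Set.univ : Set (Euc N))))
    (hf_nonneg : ∀ x ∈ Ω, ∀ z, 0 ≤ f x z)
    (hf_convex : ∀ x ∈ Ω, ConvexOn ℝ Set.univ (f x))
    (hf_growth : ∃ M : ℝ, 0 < M ∧ ∀ x ∈ Ω, ∀ z,
      1 / M * (‖z‖ - 1) ≤ |f x z| ∧ |f x z| ≤ M * (1 + ‖z‖))
    -- finiteness of the energy; automatic from the growth bound if `Ω` has finite measure
    (hf_int : IntegrableOn (fun x => f x 0) (Ω : Set (Euc d)))
    -- the range of `𝒜` is closed in `L¹`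
    (hclosed : IsClosed (LinearMap.range A.op.toFun : Set (L1 Ω n)))
    (τ : L1 Ω n) (hτ : τ ∈ LinearMap.range A.op.toFun) :
    -- the dual operator is well defined on `D(𝒜*)`
    (∀ w ∈ A.adjointDomain, ∃! v, A.IsAdjointValue w v) ∧
    -- the two problems are dual to each other with respect to the perturbation `Φ`:
    -- the primal one is to minimize `Φ(·, 0)`, the dual one is to maximize `-Φ*(0, ·)`
    (∀ u : L1 Ω N, A.perturbation f τ u 0 = if u ∈ A.feasible τ then energy f u else ⊤) ∧
    (∀ w : LInfty Ω n, -A.perturbationConj f τ 0 w =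
      if w ∈ A.adjointDomain then A.dualFunctional f τ w else ⊥) ∧
    -- equivalently, they are the inf-sup and the sup-inf of the Lagrangian
    (∀ u : L1 Ω N, (⨆ w : LInfty Ω n, A.lagrangian f τ u w) = A.perturbation f τ u 0) ∧
    (∀ w : LInfty Ω n, (⨅ u : L1 Ω N, A.lagrangian f τ u w) = -A.perturbationConj f τ 0 w) ∧
    -- there is no duality gap
    ((⨅ u ∈ A.feasible τ, energy f u) = (⨆ w ∈ A.adjointDomain, A.dualFunctional f τ w)) ∧
    -- the dual supremum is attained
    (∃ w ∈ A.adjointDomain,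
      A.dualFunctional f τ w = (⨆ w' ∈ A.adjointDomain, A.dualFunctional f τ w')) := by
  obtain ⟨M, hM, hgrowth⟩ := hf_growth
  have hf : IsConvexIntegrand Ω f M :=
    ⟨hf_cont, hf_nonneg, hf_convex, hM, fun x hx z => (le_abs_self _).trans (hgrowth x hx z).2,
      hf_int⟩
  obtain ⟨w, hw, hmax⟩ := A.exists_iInf_energy_le_dualFunctional hf hclosed hτ
  have hweak : (⨆ w ∈ A.adjointDomain, A.dualFunctional f τ w) ≤ ⨅ u ∈ A.feasible τ, energy f u :=
    iSup₂_le fun w hw => le_iInf₂ fun u hu => A.dualFunctional_le_energy hf hw hu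
  refine ⟨fun w hw => A.existsUnique_isAdjointValue hw, A.perturbation_zero_right, fun w => ?_,
    A.iSup_lagrangian hf, A.iInf_lagrangian, ?_, w, hw, ?_⟩
  · split_ifs with hw
    · exact A.neg_perturbationConj_of_mem hf hw
    · rw [A.perturbationConj_of_notMem hf hw, EReal.neg_top]
  · exact le_antisymm (hmax.trans (le_iSup₂ (f := fun w _ => A.dualFunctional f τ w) w hw)) hweak
  · exact le_antisymm (le_iSup₂ (f := fun w _ => A.dualFunctional f τ w) w hw) (hweak.trans hmax)
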